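/- **Setting.** Let $\Lambda$ be an additive abelian group (for example the torus $\mathbb T^d$) with a $\sigma$-algebra and a finite measure $dx$, let $K:\Lambda\to\mathbb R$ be symmetric, $K(-x)=K(x)$, and let $(X(x))_{x\in\Lambda}$ be a jointly measurable centred real Gaussian process with $\mathbb E[X(x)X(y)]=K(x-y)$. For $k\ge 0$ let $$H_k(X(x)) = (-v)^k e^{\xi^2/(2v)}\frac{d^k}{d\xi^k}e^{-\xi^2/(2v)}\Big|_{\xi=X(x)},\qquad v=\mathrm{Var}(X(x)),$$ be the $k$-th Hermite polynomial (Wick power). **Feynman diagrams.** $\mathbf F$ is the set of isomorphism classes of finite connected multigraphs $\Gamma=(\mathcal V,\mathcal E)$ with at least one vertex, with multiple edges allowed and self-connected vertices (loops) forbidden. Its valuation is $\Pi_{\mathbf F}(\Gamma)=\int_{\Lambda^{\mathcal V}}\prod_{e\in\mathcal E}K(x_{e_+}-x_{e_-})\,dx$, extended linearly to the span $\langle\mathbf F\rangle$, and $S_{\mathbf F}(\Gamma)=|\mathrm{Aut}(\Gamma)|$ is the number of pairs (permutation of $\mathcal V$, permutation of $\mathcal E$) compatible with the end points of the edges. **Multi-indices.**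 For a finitely supported $\beta:\mathbb N\to\mathbb N$ put $z^\beta=\prod_k z_k^{\beta(k)}$ and $S_{\mathbf M}(z^\beta)=\prod_k\beta(k)!\,(k!)^{\beta(k)}$. The counting map is $\Phi(\Gamma)=\prod_{v\in\mathcal V}z_{k(v)}$, where $k(v)$ is the number of edges attached to $v$; $\mathbf M=\Phi(\mathbf F)$; and $$\mathcal P(z^\beta)=\sum_{\Gamma\in\mathbf F:\ \Phi(\Gamma)=z^\beta}\frac{S_{\mathbf M}(z^\beta)}{S_{\mathbf F}(\Gamma)}\,\Gamma .$$ The valuation of multi-indices is defined recursively by $$\Pi_{\mathbf M}(z^\beta)=\mathbb E\Big[\prod_{k}\Big(\int_\Lambda H_k(X(x))\,dx\Big)^{\beta(k)}\Big]-\sum_{n\ge2}\ \sum_{\substack{\{\beta_1,\dots,\beta_n\}\\ \beta_1+\dots+\beta_n=\beta}}\frac{1}{\prod_j r_j!}\prod_k\binom{\beta(k)}{\beta_1(k),\dots,\beta_n(k)}\prod_{i=1}^n\Pi_{\mathbf M}(z^{\beta_i}),$$ where the inner sum runs over unordered collections, with repetition, of $n$ elements $z^{\beta_i}$ of $\mathbf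 M$, and the $r_j$ are the multiplicities of the distinct $\beta_i$ in the collection. **Claim.** For every $z^\beta\in\mathbf M$, $$\Pi_{\mathbf M}(z^\beta)=\Pi_{\mathbf F}(\mathcal P(z^\beta)).$$ Moreover $$\Pi_{\mathbf M}(z^\beta)=\sum_{\Gamma\in\mathbf F:\ \Phi(\Gamma)=z^\beta}N(\Gamma)\,\Pi_{\mathbf F}(\Gamma),$$ where $N(\Gamma)$ is the number of ways to pair up all half-edges of a collection of labelled vertices, $\beta(k)$ of them carrying $k$ labelled half-edges for each $k$, always joining half-edges of different vertices, such that the resulting graph is isomorphic to $\Gamma$. -/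

import Mathlib

open MeasureTheory ProbabilityTheory
open scoped Nat

noncomputable section

/-! ### Multigraphs -/

/-- A multigraph with vertices `V` and edges `E`: every edge has an unordered pair of distinct
end points (no self-connection); several edges may share their end points. -/
structure MultiGraph (V E : Type) where
  ends : E → Sym2 V
  not_isDiag : ∀ e, ¬ (ends e).IsDiag

namespace MultiGraph

variable {V E V' E' V'' E'' : Type}

/-- Any two vertices are joined by a path of edges, and there is at least one vertex. -/
def IsConnected (G : MultiGraph V E) : Prop :=
  (SimpleGraph.fromEdgeSet (Set.range G.ends)).Connected

/-- The arity of a vertex: the number of edges attached to it. -/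
def arity (G : MultiGraph V E) (v : V) : ℕ := Nat.card {e : E // v ∈ G.ends e}

/-- The monomial `∏ v, z_{k(v)}`, as an exponent vector: the number of vertices of each arity. -/
def arities [Fintype V] (G : MultiGraph V E) : ℕ →₀ ℕ :=
  ∑ v : V, Finsupp.single (G.arity v) 1

/-- An isomorphism of multigraphs: bijections of the vertices and of the edges which respect the
end points. -/
structure Iso (G : MultiGraph V E) (G' : MultiGraph V' E') where
  onV : V ≃ V'
  onE : E ≃ E'
  ends_onE : ∀ e, G'.ends (onE e) = (G.ends e).map onV

namespace Iso

variable {G : MultiGraph V E} {G' : MultiGraph V' E'} {G'' : MultiGraph V'' E''}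

@[ext]
theorem ext {f g : Iso G G'} (h₁ : f.onV = g.onV) (h₂ : f.onE = g.onE) : f = g := by
  cases f; cases g; cases h₁; cases h₂; rfl

def refl (G : MultiGraph V E) : Iso G G where
  onV := Equiv.refl V
  onE := Equiv.refl E
  ends_onE e := by simp

def symm (f : Iso G G') : Iso G' G where
  onV := f.onV.symm
  onE := f.onE.symm
  ends_onE e := by
    obtain ⟨e, rfl⟩ := f.onE.surjective e
    rw [f.ends_onE, Sym2.map_map]
    simp

def trans (f : Iso G G') (g : Iso G' G'') : Iso G G'' where
  onV := f.onV.trans g.onV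
  onE := f.onE.trans g.onE
  ends_onE e := by
    simp [g.ends_onE, f.ends_onE, Sym2.map_map]

theorem arity_onV (f : Iso G G') (v : V) : G'.arity (f.onV v) = G.arity v := by
  refine (Nat.card_congr (f.onE.subtypeEquiv fun e => ?_)).symm
  rw [f.ends_onE, Sym2.mem_map]
  constructor
  · intro h
    exact ⟨v, h, rfl⟩
  · rintro ⟨w, hw, h⟩
    rwa [← f.onV.injective h]

theorem arities_eq [Fintype V] [Fintype V'] (f : Iso G G') : G.arities = G'.arities := by
  unfold arities
  refine Fintype.sum_equiv f.onV _ _ fun v => ?_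
  rw [f.arity_onV]

/-- Isomorphic multigraphs have automorphism groups of the same size. -/
theorem card_aut_eq (f : Iso G G') : Nat.card (Iso G G) = Nat.card (Iso G' G') := by
  refine Nat.card_congr ⟨fun g => (f.symm.trans g).trans f, fun g => (f.trans g).trans f.symm,
    fun g => ?_, fun g => ?_⟩ <;>
  · apply ext <;> ext x <;> simp [symm, trans]

end Iso

theorem card_le_of_arities [Fintype V] [Fintype E] (G : MultiGraph V E) :
    Fintype.card E ≤ G.arities.sum fun k b => b * k := by
  have h1 : (G.arities.sum fun k b => b * k) = ∑ v : V, G.arity v := by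
    unfold arities
    rw [← Finsupp.sum_finsetSum_index (by simp) (by intros; ring)]
    simp
  rw [h1, ← Nat.card_eq_fintype_card]
  have h2 : ∑ v : V, G.arity v = Nat.card (Σ v : V, {e : E // v ∈ G.ends e}) :=
    Nat.card_sigma.symm
  rw [h2]
  refine Nat.card_le_card_of_injective
    (fun e => ⟨(Quot.out (G.ends e)).1, ⟨e, Sym2.out_fst_mem _⟩⟩) ?_
  intro e e' h
  have := congrArg (fun p : (Σ v : V, {e : E // v ∈ G.ends e}) => p.2.1) h
  simpa using this

theorem degree_arities [Fintype V] (G : MultiGraph V E) :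
    G.arities.degree = Fintype.card V := by
  simp [arities, map_sum]

end MultiGraph

/-! ### Feynman diagrams -/

/-- A connected finite multigraph without self-connection, with labelled vertices and edges. -/
structure LabelledDiagram where
  numV : ℕ
  numE : ℕ
  graph : MultiGraph (Fin numV) (Fin numE)
  isConnected : graph.IsConnected

instance LabelledDiagram.setoid : Setoid LabelledDiagram where
  r D D' := Nonempty (D.graph.Iso D'.graph)
  iseqv :=
    { refl := fun D => ⟨MultiGraph.Iso.refl D.graph⟩
      symm := fun ⟨f⟩ => ⟨f.symm⟩
      trans := fun ⟨f⟩ ⟨g⟩ => ⟨f.trans g⟩ }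

/-- The set `𝐅` of (connected, vacuum) Feynman diagrams: isomorphic graphs are identified. -/
def FeynmanDiagram : Type := Quotient LabelledDiagram.setoid

namespace FeynmanDiagram

/-- The graph `G` is a representative of the isomorphism class `Γ`. -/
def IsClassOf {V E : Type} (Γ : FeynmanDiagram) (G : MultiGraph V E) : Prop :=
  Quotient.lift (s := LabelledDiagram.setoid)
    (fun D : LabelledDiagram => Nonempty (D.graph.Iso G))
    (fun D D' (h : Nonempty (D.graph.Iso D'.graph)) => h.elim fun f =>
      propext ⟨fun ⟨g⟩ => ⟨f.symm.trans g⟩, fun ⟨g⟩ => ⟨f.trans g⟩⟩) Γ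

/-- The counting map `Φ(Γ) = ∏ v, z_{k(v)}`. A monomial `z^β` is given by its exponent vector
`β`. -/
def counting (Γ : FeynmanDiagram) : ℕ →₀ ℕ :=
  Quotient.lift (s := LabelledDiagram.setoid)
    (fun D : LabelledDiagram => D.graph.arities) (fun D D' (h : Nonempty (D.graph.Iso D'.graph)) => h.elim fun f => f.arities_eq) Γ

/-- The symmetry factor `S_F(Γ) = |Aut(Γ)|`. -/
def symmetryFactor (Γ : FeynmanDiagram) : ℕ :=
  Quotient.lift (s := LabelledDiagram.setoid)
    (fun D : LabelledDiagram => Nat.card (D.graph.Iso D.graph))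
    (fun D D' (h : Nonempty (D.graph.Iso D'.graph)) => h.elim fun f => f.card_aut_eq) Γ

theorem counting_ne_zero (Γ : FeynmanDiagram) : Γ.counting ≠ 0 := by
  induction Γ using Quotient.inductionOn with
  | h D =>
    intro h
    have h1 : D.graph.arities = 0 := h
    have h2 := D.graph.degree_arities
    rw [h1] at h2
    obtain ⟨v⟩ := D.isConnected.nonempty
    have h3 : D.numV = 0 := by simpa using h2.symm
    exact absurd v.isLt (by omega)

/-- Only finitely many Feynman diagrams have given numbers of vertices of each arity. -/
theorem finite_fibre (β : ℕ →₀ ℕ) : {Γ : FeynmanDiagram | Γ.counting = β}.Finite := by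
  let T := Σ n : Fin (β.degree + 1), Σ m : Fin ((β.sum fun k b => b * k) + 1),
    {G : MultiGraph (Fin n) (Fin m) // G.IsConnected}
  have hfin : ∀ n m : ℕ, Finite (MultiGraph (Fin n) (Fin m)) := fun n m =>
    Finite.of_injective (β := Fin m → Sym2 (Fin n)) MultiGraph.ends
      (by rintro ⟨e, _⟩ ⟨e', _⟩ h; cases h; rfl)
  have : Finite T := inferInstance
  let F : T → FeynmanDiagram := fun t =>
    Quotient.mk LabelledDiagram.setoid ⟨t.1, t.2.1, t.2.2.1, t.2.2.2⟩
  refine (Set.finite_range F).subset ?_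
  intro Γ hΓ
  induction Γ using Quotient.inductionOn with
  | h D =>
    have h1 : D.graph.arities = β := hΓ
    have h2 := D.graph.degree_arities
    have h3 := D.graph.card_le_of_arities
    rw [h1, Fintype.card_fin] at h2 h3
    exact ⟨⟨⟨D.numV, by omega⟩, ⟨D.numE, by omega⟩, ⟨D.graph, D.isConnected⟩⟩, rfl⟩

/-- The finite set of the Feynman diagrams `Γ` with `Φ(Γ) = z^β`. -/
def fibre (β : ℕ →₀ ℕ) : Finset FeynmanDiagram := (finite_fibre β).toFinset

@[simp]
theorem mem_fibre {β : ℕ →₀ ℕ} {Γ : FeynmanDiagram} : Γ ∈ fibre β ↔ Γ.counting = β := by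
  simp [fibre]

end FeynmanDiagram

/-! ### Valuation of Feynman diagrams -/

section Valuation

variable {Λ : Type*} [AddCommGroup Λ]

/-- The symmetric kernel `K` as the function `{x, y} ↦ K (x - y)` of an unordered pair. -/
def edgeKernel (K : Λ → ℝ) (hK : Function.Even K) : Sym2 Λ → ℝ :=
  Sym2.lift ⟨fun x y => K (x - y), fun x y => by
    change K (x - y) = K (y - x)
    rw [← neg_sub y x, hK]⟩

variable [MeasurableSpace Λ]

/-- `∫ ∏ e, K (x_{e₊} - x_{e₋}) dx` over all maps `x` from the vertices to `Λ`. -/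
def MultiGraph.valuation {V E : Type} [Fintype V] [Fintype E] (μ : Measure Λ)
    (K : Λ → ℝ) (hK : Function.Even K) (G : MultiGraph V E) : ℝ :=
  ∫ x : V → Λ, ∏ e : E, edgeKernel K hK ((G.ends e).map x) ∂(Measure.pi fun _ => μ)

theorem MultiGraph.Iso.valuation_eq {V E V' E' : Type} [Fintype V] [Fintype E] [Fintype V']
    [Fintype E'] {G : MultiGraph V E} {G' : MultiGraph V' E'} (f : G.Iso G') (μ : Measure Λ)
    [SigmaFinite μ] (K : Λ → ℝ) (hK : Function.Even K) :
    G.valuation μ K hK = G'.valuation μ K hK := by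
  unfold MultiGraph.valuation
  have h := measurePreserving_piCongrLeft (fun _ : V' => μ) f.onV
  rw [← h.integral_comp']
  congr 1
  funext x
  refine Fintype.prod_equiv f.onE _ _ fun e => ?_
  rw [f.ends_onE, Sym2.map_map]
  congr 2
  funext v
  simp [MeasurableEquiv.coe_piCongrLeft, Equiv.piCongrLeft_apply_apply]

/-- The valuation `Π_F(Γ)` of a Feynman diagram. -/
def FeynmanDiagram.valuation (μ : Measure Λ) [SigmaFinite μ] (K : Λ → ℝ)
    (hK : Function.Even K) (Γ : FeynmanDiagram) : ℝ :=
  Quotient.lift (s := LabelledDiagram.setoid)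
    (fun D : LabelledDiagram => D.graph.valuation μ K hK)
    (fun D D' (h : Nonempty (D.graph.Iso D'.graph)) => h.elim fun f => f.valuation_eq μ K hK) Γ

/-- The valuation `Π_F` extended linearly to the linear span `⟨𝐅⟩` of the Feynman diagrams. -/
def valuationF (μ : Measure Λ) [SigmaFinite μ] (K : Λ → ℝ) (hK : Function.Even K) :
    (FeynmanDiagram →₀ ℝ) →ₗ[ℝ] ℝ :=
  Finsupp.linearCombination ℝ (FeynmanDiagram.valuation μ K hK)

end Valuation

/-! ### Multi-indices, the map `𝒫` and pairings of half-edges -/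

namespace MultiIndex

/-- The set `𝐌` of the multi-indices which are the image of a Feynman diagram under `Φ`. -/
def admissible : Set (ℕ →₀ ℕ) := Set.range FeynmanDiagram.counting

/-- The symmetry factor `S_M(z^β) = ∏ k, β(k)! (k!)^β(k)`. -/
def symmetryFactor (β : ℕ →₀ ℕ) : ℕ := β.prod fun k b => b ! * (k !) ^ b

/-- The map `𝒫(z^β) = ∑_{Γ : Φ(Γ) = z^β} (S_M(z^β) / S_F(Γ)) Γ`. -/
def mapP (β : ℕ →₀ ℕ) : FeynmanDiagram →₀ ℝ :=
  ∑ Γ ∈ FeynmanDiagram.fibre β,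
    Finsupp.single Γ ((symmetryFactor β : ℝ) / (Γ.symmetryFactor : ℝ))

/-- The vertices of the pre-Feynman diagram `z^β`: there are `β k` of them of arity `k`. -/
abbrev Vertex (β : ℕ →₀ ℕ) : Type := Σ k : β.support, Fin (β k)

/-- The half-edges of the pre-Feynman diagram `z^β`: a vertex of arity `k` carries `k` of them. -/
abbrev HalfEdge (β : ℕ →₀ ℕ) : Type := Σ v : Vertex β, Fin (v.1 : ℕ)

/-- A pairing of all the half-edges of `z^β` which joins half-edges of different vertices. -/
structure Pairing (β : ℕ →₀ ℕ) where
  pairs : Set (Sym2 (HalfEdge β))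
  existsUnique_mem : ∀ h : HalfEdge β, ∃! p, p ∈ pairs ∧ h ∈ p
  not_isDiag : ∀ p ∈ pairs, ¬ (p.map Sigma.fst).IsDiag

/-- The graph formed by a pairing: the edges are the pairs of half-edges. -/
def Pairing.graph {β : ℕ →₀ ℕ} (p : Pairing β) : MultiGraph (Vertex β) p.pairs where
  ends e := e.1.map Sigma.fst
  not_isDiag e := p.not_isDiag e.1 e.2

end MultiIndex

/-- `N(Γ)`: the number of pairings of the half-edges of `Φ(Γ)` which form a graph isomorphic
to `Γ`. -/
def FeynmanDiagram.pairingCount (Γ : FeynmanDiagram) : ℕ :=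
  Nat.card {p : MultiIndex.Pairing Γ.counting // Γ.IsClassOf p.graph}

/-! ### Valuation of multi-indices -/

namespace MultiIndex

/-- The forests `z^{β₁} ⋯ z^{βₙ}` (unordered, with repetition) of `n ≥ 2` multi-indices in `𝐌`
with `β₁ + ⋯ + βₙ = β`. -/
def IsSplitting (β : ℕ →₀ ℕ) (f : Multiset (ℕ →₀ ℕ)) : Prop :=
  2 ≤ Multiset.card f ∧ (∀ γ ∈ f, γ ∈ admissible) ∧ f.sum = β

theorem ne_zero_of_admissible {γ : ℕ →₀ ℕ} (h : γ ∈ admissible) : γ ≠ 0 := by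
  obtain ⟨Γ, rfl⟩ := h
  exact Γ.counting_ne_zero

theorem finite_splittings (β : ℕ →₀ ℕ) : {f | IsSplitting β f}.Finite := by
  classical
  refine (Multiset.finite_toSet (Multiset.powerset (β.degree • (Finset.Iic β).val))).subset ?_
  rintro f ⟨-, hM, hsum⟩
  have hcard : Multiset.card f ≤ β.degree := by
    rw [← hsum, map_multiset_sum]
    have := Multiset.card_nsmul_le_sum (s := f.map Finsupp.degree) (a := 1) (by
      intro x hx
      obtain ⟨γ, hγ, rfl⟩ := Multiset.mem_map.1 hx
      have := ne_zero_of_admissible (hM γ hγ)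
      have h0 : γ.degree ≠ 0 := fun h => this ((Finsupp.degree_eq_zero_iff γ).1 h)
      omega)
    simpa using this
  simp only [Set.mem_ofPred_eq, Multiset.mem_powerset, Multiset.le_iff_count]
  intro γ
  by_cases hγ : γ ∈ f
  · have h1 : γ ≤ β := hsum ▸ Multiset.single_le_sum (fun _ _ => zero_le) γ hγ
    have h2 : Multiset.count γ (Finset.Iic β).val = 1 :=
      Multiset.count_eq_one_of_mem (Finset.Iic β).nodup (by simpa using h1)
    rw [Multiset.count_nsmul, h2, mul_one]
    exact (Multiset.count_le_card γ f).trans hcard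
  · simp [Multiset.count_eq_zero_of_notMem hγ]

/-- The finite set of the forests that split `β` into at least two multi-indices. -/
def splittings (β : ℕ →₀ ℕ) : Finset (Multiset (ℕ →₀ ℕ)) := (finite_splittings β).toFinset

@[simp]
theorem mem_splittings {β : ℕ →₀ ℕ} {f : Multiset (ℕ →₀ ℕ)} :
    f ∈ splittings β ↔ IsSplitting β f := by
  simp [splittings]

theorem degree_lt_of_mem {β γ : ℕ →₀ ℕ} {f : Multiset (ℕ →₀ ℕ)} (hf : IsSplitting β f)
    (hγ : γ ∈ f) : γ.degree < β.degree := by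
  obtain ⟨hcard, hM, hsum⟩ := hf
  obtain ⟨g, rfl⟩ := Multiset.exists_cons_of_mem hγ
  have hg : g ≠ 0 := by
    rintro rfl
    simp at hcard
  obtain ⟨δ, hδ⟩ := Multiset.exists_mem_of_ne_zero hg
  have h1 : δ ≤ g.sum := Multiset.single_le_sum (fun _ _ => zero_le) δ hδ
  have h2 := Finsupp.degree_mono h1
  have h3 : δ.degree ≠ 0 := fun h =>
    ne_zero_of_admissible (hM δ (Multiset.mem_cons_of_mem hδ)) ((Finsupp.degree_eq_zero_iff δ).1 h)
  rw [← hsum, Multiset.sum_cons, map_add]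
  omega

open Classical in
/-- The number of ways to split the vertices of the forest `z^{β₁} ⋯ z^{βₙ}`, of which there are
`β(k) = β₁(k) + ⋯ + βₙ(k)` of arity `k`, into unordered groups of the types `β₁, …, βₙ`: the
product over `k` of the multinomial coefficients `β(k)! / (β₁(k)! ⋯ βₙ(k)!)`, divided by `r!` for
each multi-index that occurs `r` times in the forest (the groups of the same type are not
ordered). -/
def splitCount (f : Multiset (ℕ →₀ ℕ)) : ℝ :=
  (∏ k ∈ f.sum.support, ((f.map fun γ => γ k).multinomial : ℝ)) /
    ∏ γ ∈ f.toFinset, ((f.count γ)! : ℝ)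

/-- Given `E(z^β)` for all `β`, the recursively defined
`c(z^β) = E(z^β) - ∑_{forests z^{β₁} ⋯ z^{βₙ}, n ≥ 2} splitCount * ∏ i, c(z^{βᵢ})`. -/
def connectedPart (E : (ℕ →₀ ℕ) → ℝ) (β : ℕ →₀ ℕ) : ℝ :=
  E β - ∑ f ∈ (splittings β).attach, splitCount f.1 *
    (f.1.attach.map fun γ => connectedPart E γ.1).prod
termination_by β.degree
decreasing_by exact degree_lt_of_mem (mem_splittings.1 f.2) γ.2

theorem connectedPart_eq (E : (ℕ →₀ ℕ) → ℝ) (β : ℕ →₀ ℕ) :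
    connectedPart E β =
      E β - ∑ f ∈ splittings β, splitCount f * (f.map (connectedPart E)).prod := by
  rw [connectedPart]
  congr 1
  rw [← Finset.sum_attach (splittings β)]
  refine Finset.sum_congr rfl fun f _ => ?_
  rw [Multiset.attach_map_val' f.1 (connectedPart E)]

end MultiIndex

/-- The Hermite polynomial of variance `v`,
`H_n(x) = (-v)^n exp(x² / (2v)) (d/dx)^n exp(-x² / (2v))`. -/
def hermiteVar (v : ℝ) (n : ℕ) (x : ℝ) : ℝ :=
  (-v) ^ n * Real.exp (x ^ 2 / (2 * v)) *
    iteratedDeriv n (fun y : ℝ => Real.exp (-y ^ 2 / (2 * v))) x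

namespace MultiIndex

variable {Λ Ω : Type*} [MeasurableSpace Λ] [MeasurableSpace Ω]

/-- `𝔼[∏ k, (∫_Λ H_k(X(x)) dx)^β(k)]`. -/
def moment (μ : Measure Λ) (P : Measure Ω) (X : Λ → Ω → ℝ) (β : ℕ →₀ ℕ) : ℝ :=
  ∫ ω, β.prod (fun k b => (∫ x, hermiteVar Var[X x; P] k (X x ω) ∂μ) ^ b) ∂P

/-- The valuation `Π_M(z^β)` of a multi-index: the moment minus the disconnected
contributions. -/
def valuation (μ : Measure Λ) (P : Measure Ω) (X : Λ → Ω → ℝ) (β : ℕ →₀ ℕ) : ℝ :=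
  connectedPart (moment μ P X) β

end MultiIndex

end

/-!
The moment `𝔼[∏ k, (∫ H_k(X(x)) dx)^β(k)]` is an integral over the positions of the vertices of
`z^β` of the expectation of a product of Hermite polynomials, one for each vertex. By Wick's
formula (`integral_prod_hermitePoly`) this expectation is a sum over the pairings of all
half-edges which never join two half-edges of the same vertex, so that the moment is the sum of the
integrals of all pairings (`moment_eq_sum_pairings`). Wick's formula is proved by Gaussian
integration by parts: `H_{n+1} = ξ H_n - v H_n'` removes exactly the contractions of a vertex with
itself, and what remains is the recursion which selects the partner of one half-edge
(`sum_pairings_insert`).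

A pairing is a connected pairing of the component of some vertex together with an arbitrary pairing
of the other vertices, and its integral is the product of the two integrals. Summed over the
vertices of one arity `k`, this becomes the recursion `z_k ∂_k E = (z_k ∂_k C) E` for the
exponential generating functions `E` of all pairings and `C` of the connected ones
(`MultiIndex.mul_pairingSum`). The sum over all forests of multi-indices with the weights
`splitCount` obeys the same recursion (`MultiIndex.mul_forestSum`), because a forest arises by
adding a multi-index to a smaller forest. Hence the moments are sums over forests of products of
values of `C`, and the recursion which defines the valuation of a multi-index recovers `C`
(`MultiIndex.connectedPart_forestSum`).

Sorted by isomorphism classes, `C(β)` is the sum of `N(Γ) Π_F(Γ)` over the Feynman diagrams `Γ`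
with `Φ(Γ) = z^β`. Finally `N(Γ) |Aut Γ| = S_M(z^β)`: both sides count the labellings of the
half-edges of `Γ` by the half-edges of `z^β`, since such a labelling amounts to a pairing together
with an isomorphism from `Γ` to the graph which it forms.
-/

/-! ### Hermite polynomials -/

open Polynomial in
/-- The Hermite polynomial of variance `v` as a formal polynomial. For `v = 0` the recursion is cut
off after `H_0 = 1`: this is what the formula of `hermiteVar` gives there, because division by zero
turns the exponentials into the constant `1`. -/
noncomputable def hermitePoly (v : ℝ) : ℕ → ℝ[X]
  | 0 => 1
  | n + 1 => if v = 0 then 0 else X * hermitePoly v n - C v * derivative (hermitePoly v n)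

section Hermite

open Polynomial

theorem hermitePoly_zero_succ (n : ℕ) : hermitePoly 0 (n + 1) = 0 := by
  simp [hermitePoly]

theorem hermitePoly_succ {v : ℝ} (hv : v ≠ 0) (n : ℕ) :
    hermitePoly v (n + 1) = X * hermitePoly v n - C v * derivative (hermitePoly v n) := by
  simp [hermitePoly, hv]

theorem derivative_hermitePoly {v : ℝ} (hv : v ≠ 0) (n : ℕ) :
    derivative (hermitePoly v n) = (n : ℝ[X]) * hermitePoly v (n - 1) := by
  induction n with
  | zero => simp [hermitePoly]
  | succ n ih =>
    rw [hermitePoly_succ hv]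
    cases n with
    | zero => simp [hermitePoly]
    | succ m =>
      have h := hermitePoly_succ hv m
      simp only [Nat.add_sub_cancel] at ih ⊢
      simp only [derivative_sub, derivative_mul, derivative_X, derivative_C, ih,
        derivative_natCast]
      push_cast
      linear_combination (-(m : ℝ[X]) - 1) * h

theorem hermiteVar_eq_eval (v : ℝ) (n : ℕ) (x : ℝ) :
    hermiteVar v n x = (hermitePoly v n).eval x := by
  rcases eq_or_ne v 0 with rfl | hv
  · cases n with
    | zero => simp [hermiteVar, hermitePoly]
    | succ n => simp [hermiteVar, hermitePoly]
  have key : iteratedDeriv n (fun y : ℝ => Real.exp (-y ^ 2 / (2 * v))) =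
      fun y => (-v)⁻¹ ^ n * (hermitePoly v n).eval y * Real.exp (-y ^ 2 / (2 * v)) := by
    induction n with
    | zero => simp [hermitePoly]
    | succ n ih =>
      rw [iteratedDeriv_succ, ih]
      funext y
      have h1 : HasDerivAt (fun y : ℝ => Real.exp (-y ^ 2 / (2 * v)))
          (Real.exp (-y ^ 2 / (2 * v)) * (-(2 * y) / (2 * v))) y := by
        simpa using (((hasDerivAt_pow 2 y).neg.div_const (2 * v))).exp
      have h2 := (((hermitePoly v n).hasDerivAt y).const_mul ((-v)⁻¹ ^ n)).mul h1
      refine h2.deriv.trans ?_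
      rw [hermitePoly_succ hv]
      simp only [eval_sub, eval_mul, eval_X, eval_C]
      have h3 : (-v)⁻¹ ^ n = (-v)⁻¹ ^ (n + 1) * (-v) := by
        rw [pow_succ, inv_mul_cancel_right₀ (neg_ne_zero.2 hv)]
      rw [h3]
      field_simp
      ring
  rw [hermiteVar, key]
  have h3 : Real.exp (x ^ 2 / (2 * v)) * Real.exp (-x ^ 2 / (2 * v)) = 1 := by
    rw [← Real.exp_add, ← Real.exp_zero]
    congr 1
    ring
  have h4 : (-v) ^ n * (-v)⁻¹ ^ n = 1 := by
    rw [← mul_pow, mul_inv_cancel₀ (neg_ne_zero.2 hv), one_pow]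
  linear_combination ((-v) ^ n * (-v)⁻¹ ^ n * (hermitePoly v n).eval x) * h3 +
    (hermitePoly v n).eval x * h4

end Hermite

/-! ### Functions with moments of all orders -/

/-- The algebra of the functions which have finite moments of all orders. -/
def momentAlgebra {α : Type*} [MeasurableSpace α] (ν : Measure α) [IsFiniteMeasure ν] :
    Subalgebra ℝ (α → ℝ) where
  carrier := {f | ∀ p : ENNReal, p ≠ ⊤ → MemLp f p ν}
  mul_mem' {f g} hf hg p hp := by
    have h2 : ENNReal.HolderTriple (2 * p) (2 * p) p := ⟨by
      rw [ENNReal.mul_inv (Or.inl (by simp)) (Or.inl (by simp)), ← add_mul,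
        ENNReal.inv_two_add_inv_two, one_mul]⟩
    have h3 : 2 * p ≠ ⊤ := ENNReal.mul_ne_top (by simp) hp
    exact (hg _ h3).mul (hf _ h3)
  add_mem' hf hg p hp := (hf p hp).add (hg p hp)
  algebraMap_mem' r p hp := memLp_const r

section momentAlgebra

variable {α : Type*} [MeasurableSpace α] {ν : Measure α} [IsFiniteMeasure ν] {f : α → ℝ}

theorem integrable_of_mem_momentAlgebra (hf : f ∈ momentAlgebra ν) : Integrable f ν :=
  memLp_one_iff_integrable.1 (hf 1 (by simp))

theorem polynomial_mem_momentAlgebra (hf : f ∈ momentAlgebra ν) (p : Polynomial ℝ) :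
    (fun a => p.eval (f a)) ∈ momentAlgebra ν := by
  convert Algebra.adjoin_le (Set.singleton_subset_iff.2 hf)
    (Polynomial.aeval_mem_adjoin_singleton ℝ f (p := p)) using 1
  funext a
  rw [Polynomial.aeval_fn_apply, Polynomial.coe_aeval_eq_eval]

theorem prod_mem_momentAlgebra {ι : Type*} (s : Finset ι) {F : ι → α → ℝ}
    (hF : ∀ i ∈ s, F i ∈ momentAlgebra ν) : (fun a => ∏ i ∈ s, F i a) ∈ momentAlgebra ν := by
  convert Subalgebra.prod_mem (momentAlgebra ν) hF using 1
  funext a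
  rw [Finset.prod_apply]

end momentAlgebra

/-! ### Gaussian integration by parts -/

section Stein

open Polynomial

theorem id_mem_momentAlgebra (v : NNReal) : (fun y : ℝ => y) ∈ momentAlgebra (gaussianReal 0 v) :=
  fun p hp => memLp_id_gaussianReal' p hp

theorem integral_mul_eval_gaussianReal (v : NNReal) (p : ℝ[X]) :
    ∫ y, y * p.eval y ∂(gaussianReal 0 v) = v * ∫ y, (derivative p).eval y ∂(gaussianReal 0 v) := by
  rcases eq_or_ne v 0 with rfl | hv
  · simp [gaussianReal_zero_var]
  have hint (q : ℝ[X]) : Integrable (fun y => q.eval y * gaussianPDFReal 0 v y) := by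
    have h := integrable_of_mem_momentAlgebra
      (polynomial_mem_momentAlgebra (id_mem_momentAlgebra v) q)
    rw [gaussianReal_of_var_ne_zero _ hv, integrable_withDensity_iff_integrable_smul'
      (measurable_gaussianPDF _ _) (ae_of_all _ fun _ => gaussianPDF_lt_top)] at h
    refine h.congr (ae_of_all _ fun y => ?_)
    simp [toReal_gaussianPDF, mul_comm]
  have hpdf (y : ℝ) : HasDerivAt (gaussianPDFReal 0 v) (-(y / v) * gaussianPDFReal 0 v y) y := by
    rw [gaussianPDFReal_def]
    have h1 : HasDerivAt (fun y : ℝ => Real.exp (-(y - 0) ^ 2 / (2 * v)))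
        (Real.exp (-(y - 0) ^ 2 / (2 * v)) * (-(2 * (y - 0)) / (2 * v))) y := by
      simpa using ((((hasDerivAt_id y).sub_const 0).pow 2).neg.div_const (2 * (v : ℝ))).exp
    refine (h1.const_mul _).congr_deriv ?_
    have : (v : ℝ) ≠ 0 := by exact_mod_cast hv
    field_simp
    ring
  have hv' : (v : ℝ) ≠ 0 := by exact_mod_cast hv
  have key := integral_mul_deriv_eq_deriv_mul_of_integrable
    (u := fun y => p.eval y) (v := gaussianPDFReal 0 v) (fun y _ => p.hasDerivAt y)
    (fun y _ => hpdf y) ((hint (C (-(v : ℝ)⁻¹) * (X * p))).congr (ae_of_all _ fun y => by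
      simp; field_simp)) (hint _) (hint _)
  rw [integral_gaussianReal_eq_integral_smul hv, integral_gaussianReal_eq_integral_smul hv]
  calc ∫ y, gaussianPDFReal 0 v y • (y * p.eval y)
      = ∫ y, -(v : ℝ) * (p.eval y * (-(y / v) * gaussianPDFReal 0 v y)) := by
        refine integral_congr_ae (ae_of_all _ fun y => ?_)
        simp only [smul_eq_mul]
        field_simp
    _ = v * ∫ y, (derivative p).eval y * gaussianPDFReal 0 v y := by
        rw [integral_const_mul, key]
        ring
    _ = _ := by
        congr 1
        refine integral_congr_ae (ae_of_all _ fun y => ?_)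
        simp [mul_comm]

variable {Ω : Type*} [MeasurableSpace Ω] {P : Measure Ω}

theorem ProbabilityTheory.HasGaussianLaw.mem_momentAlgebra [IsFiniteMeasure P] {Y : Ω → ℝ}
    (hY : HasGaussianLaw Y P) :
    Y ∈ momentAlgebra P := fun _ hp => hY.memLp hp

theorem integral_mul_eq_zero_of_integral_sq_eq_zero {Y Z : Ω → ℝ} (hY : MemLp Y 2 P)
    (h : ∫ ω, Y ω * Y ω ∂P = 0) : ∫ ω, Y ω * Z ω ∂P = 0 := by
  have h1 : (fun ω => Y ω * Y ω) =ᵐ[P] 0 :=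
    (integral_eq_zero_iff_of_nonneg (fun ω => mul_self_nonneg _) (hY.integrable_mul hY)).1 h
  refine integral_eq_zero_of_ae ?_
  filter_upwards [h1] with ω hω
  have : Y ω = 0 := mul_self_eq_zero.1 hω
  simp [this]

/-- **Gaussian integration by parts** for products of polynomials. The part of the process which
is uncorrelated with `Y i₀` is independent of it, so that it suffices to integrate by parts in the
variable `Y i₀`. -/
theorem integral_mul_prod_eval_of_isGaussianProcess {ι : Type*} [Fintype ι] [DecidableEq ι]
    [IsProbabilityMeasure P] {Y : ι → Ω → ℝ} (hY : IsGaussianProcess Y P)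
    (hc : ∀ i, ∫ ω, Y i ω ∂P = 0) (i₀ : ι) (p : ι → ℝ[X]) :
    ∫ ω, Y i₀ ω * ∏ i, (p i).eval (Y i ω) ∂P =
      ∑ j, (∫ ω, Y i₀ ω * Y j ω ∂P) *
        ∫ ω, (derivative (p j)).eval (Y j ω) *
          ∏ i ∈ Finset.univ.erase j, (p i).eval (Y i ω) ∂P := by
  have hmem (i : ι) : Y i ∈ momentAlgebra P := (hY.hasGaussianLaw_eval i).mem_momentAlgebra
  have hL2 (i : ι) : MemLp (Y i) 2 P := hmem i 2 (by simp)
  set σ : ℝ := ∫ ω, Y i₀ ω * Y i₀ ω ∂P with hσ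
  have hcov (i j : ι) : cov[Y i, Y j; P] = ∫ ω, Y i ω * Y j ω ∂P := by
    rw [covariance_eq_sub (hL2 i) (hL2 j), hc i]
    simp
  have hσ0 : 0 ≤ σ := integral_nonneg fun ω => mul_self_nonneg _
  -- The regression coefficients of the process on `Y i₀`.
  obtain ⟨a, ha⟩ : ∃ a : ι → ℝ, ∀ j, a j * σ = ∫ ω, Y i₀ ω * Y j ω ∂P := by
    rcases eq_or_ne σ 0 with h0 | h0
    · exact ⟨0, fun j => by simp [integral_mul_eq_zero_of_integral_sq_eq_zero (hL2 i₀) h0]⟩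
    · exact ⟨fun j => (∫ ω, Y i₀ ω * Y j ω ∂P) / σ, fun j => div_mul_cancel₀ _ h0⟩
  let Z : ι → Ω → ℝ := fun j ω => Y j ω - a j * Y i₀ ω
  have hjoint : IsGaussianProcess (Sum.elim (fun _ : Unit => Y i₀) Z) P := by
    refine hY.of_isGaussianProcess fun s => ?_
    refine ⟨Finset.univ, Sum.elim
      (fun _ => ContinuousLinearMap.proj ⟨i₀, Finset.mem_univ _⟩)
      (fun j => ContinuousLinearMap.proj ⟨j, Finset.mem_univ _⟩ -
        a j • ContinuousLinearMap.proj ⟨i₀, Finset.mem_univ _⟩) s, fun ω => ?_⟩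
    cases s <;> simp [Z]
  have hYm (i : ι) : AEMeasurable (Y i) P := hY.aemeasurable i
  have hZm (i : ι) : AEMeasurable (Z i) P := (hYm i).sub ((hYm i₀).const_mul _)
  have hind' : IndepFun (fun ω (_ : Unit) => Y i₀ ω) (fun ω j => Z j ω) P := by
    refine hjoint.indepFun_of_covariance_eq_zero (fun _ => hYm i₀) hZm fun _ j => ?_
    have h1 : Z j = Y j - fun ω => a j * Y i₀ ω := rfl
    rw [h1, covariance_sub_right (hL2 i₀) (hL2 j) ((hL2 i₀).const_mul _),
      covariance_const_mul_right, hcov, hcov, ← hσ, ha, sub_self]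
  have hind : IndepFun (Y i₀) (fun ω j => Z j ω) P :=
    hind'.comp (measurable_pi_apply ()) measurable_id
  have hZv : AEMeasurable (fun ω j => Z j ω) P := aemeasurable_pi_lambda _ hZm
  let ρ : Measure (ι → ℝ) := P.map fun ω j => Z j ω
  have hρ : IsProbabilityMeasure ρ := Measure.isProbabilityMeasure_map hZv
  have hlaw : P.map (Y i₀) = gaussianReal 0 σ.toNNReal := by
    rw [(hY.hasGaussianLaw_eval i₀).map_eq_gaussianReal, hc, ← covariance_self (hYm i₀), hcov]
  have hmap : P.map (fun ω => (Y i₀ ω, fun j => Z j ω)) = (gaussianReal 0 σ.toNNReal).prod ρ := by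
    rw [← hlaw]
    exact (indepFun_iff_map_prod_eq_prod_map_map (hYm i₀) hZv).1 hind
  have hpair : AEMeasurable (fun ω => (Y i₀ ω, fun j => Z j ω)) P := (hYm i₀).prodMk hZv
  -- Integrate first in `Y i₀`, then in the independent variables `Z`.
  have fub (F : (ι → ℝ) → ℝ[X]) (hF : Continuous fun q : ℝ × (ι → ℝ) => (F q.2).eval q.1)
      (hint : Integrable (fun ω => (F fun j => Z j ω).eval (Y i₀ ω)) P) :
      ∫ ω, (F fun j => Z j ω).eval (Y i₀ ω) ∂P =
        ∫ z, ∫ y, (F z).eval y ∂(gaussianReal 0 σ.toNNReal) ∂ρ := by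
    have h1 : ∫ ω, (F fun j => Z j ω).eval (Y i₀ ω) ∂P =
        ∫ q : ℝ × (ι → ℝ), (F q.2).eval q.1 ∂(P.map (fun ω => (Y i₀ ω, fun j => Z j ω))) :=
      (integral_map hpair hF.aestronglyMeasurable).symm
    rw [h1, hmap]
    refine integral_prod_symm _ ?_
    rw [← hmap]
    exact (integrable_map_measure hF.aestronglyMeasurable hpair).2 hint
  let Q : ι → (ι → ℝ) → ℝ[X] := fun i z => C (a i) * X + C (z i)
  have hQ (i : ι) (ω : Ω) : (Q i fun j => Z j ω).eval (Y i₀ ω) = Y i ω := by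
    simp [Q, Z]
  have hcont (i : ι) (q : ℝ[X]) :
      Continuous fun x : ℝ × (ι → ℝ) => (q.comp (Q i x.2)).eval x.1 := by
    simp only [eval_comp, Q, eval_add, eval_mul, eval_C, eval_X]
    fun_prop
  have hG1 : ∫ ω, Y i₀ ω * ∏ i, (p i).eval (Y i ω) ∂P =
      ∫ z, ∫ y, y * (∏ i, (p i).comp (Q i z)).eval y ∂(gaussianReal 0 σ.toNNReal) ∂ρ := by
    have h := fub (fun z => X * ∏ i, (p i).comp (Q i z)) ?_ ?_
    · simpa only [eval_mul, eval_X, eval_prod, eval_comp, hQ] using h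
    · simp only [eval_mul, eval_X, eval_prod]
      exact continuous_fst.mul (continuous_finsetProd _ fun i _ => hcont i (p i))
    · simp only [eval_mul, eval_X, eval_prod, eval_comp, hQ]
      exact integrable_of_mem_momentAlgebra ((momentAlgebra P).mul_mem (hmem i₀)
        (prod_mem_momentAlgebra _ fun i _ => polynomial_mem_momentAlgebra (hmem i) (p i)))
  have hder (j : ι) (z : ι → ℝ) :
      derivative ((p j).comp (Q j z)) = C (a j) * (derivative (p j)).comp (Q j z) := by
    rw [derivative_comp]
    simp [Q]
  have hintj (j : ι) : (fun ω => (derivative (p j)).eval (Y j ω) *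
      ∏ i ∈ Finset.univ.erase j, (p i).eval (Y i ω)) ∈ momentAlgebra P :=
    (momentAlgebra P).mul_mem (polynomial_mem_momentAlgebra (hmem j) _)
      (prod_mem_momentAlgebra _ fun i _ => polynomial_mem_momentAlgebra (hmem i) (p i))
  have hG2 : ∫ ω, ∑ j, a j * ((derivative (p j)).eval (Y j ω) *
        ∏ i ∈ Finset.univ.erase j, (p i).eval (Y i ω)) ∂P =
      ∫ z, ∫ y, (derivative (∏ i, (p i).comp (Q i z))).eval y
        ∂(gaussianReal 0 σ.toNNReal) ∂ρ := by
    have h := fub (fun z => ∑ j, C (a j) * ((derivative (p j)).comp (Q j z) *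
      ∏ i ∈ Finset.univ.erase j, (p i).comp (Q i z))) ?_ ?_
    · simp only [eval_finsetSum, eval_mul, eval_C, eval_prod, eval_comp, hQ] at h
      rw [h]
      congr 1
      funext z
      congr 1
      funext y
      rw [derivative_prod_finset, eval_finsetSum]
      refine Finset.sum_congr rfl fun j _ => ?_
      rw [hder]
      simp only [eval_mul, eval_C, eval_prod, eval_comp]
      ring
    · simp only [eval_finsetSum, eval_mul, eval_C, eval_prod]
      exact continuous_finsetSum _ fun j _ => continuous_const.mul ((hcont j _).mul
        (continuous_finsetProd _ fun i _ => hcont i (p i)))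
    · simp only [eval_finsetSum, eval_mul, eval_C, eval_prod, eval_comp, hQ]
      exact integrable_finsetSum _ fun j _ =>
        (integrable_of_mem_momentAlgebra (hintj j)).const_mul _
  rw [hG1]
  simp_rw [integral_mul_eval_gaussianReal]
  rw [integral_const_mul, ← hG2, integral_finsetSum _ fun j _ =>
    (integrable_of_mem_momentAlgebra (hintj j)).const_mul _, Finset.mul_sum]
  refine Finset.sum_congr rfl fun j _ => ?_
  rw [integral_const_mul, ← ha, Real.coe_toNNReal _ hσ0]
  ring

end Stein

/-! ### Pairings of half-edges and Wick's formula -/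

/-- The half-edges `h : H` are attached to the vertices `π h : V`. A pairing of the half-edges in
`s` is given by its set of pairs. It must not join two half-edges of the same vertex. -/
def IsPairing {H V : Type} (π : H → V) (s : Finset H) (P : Finset (Sym2 H)) : Prop :=
  (∀ h ∈ s, ∃! p, p ∈ P ∧ h ∈ p) ∧ ∀ p ∈ P, (∀ h ∈ p, h ∈ s) ∧ ¬ (p.map π).IsDiag

open Classical in
/-- The finite set of the pairings of the half-edges in `s`. -/
noncomputable def pairings {H V : Type} [Fintype H] (π : H → V) (s : Finset H) :
    Finset (Finset (Sym2 H)) :=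
  Finset.univ.filter (IsPairing π s)

section Pairings

variable {H V : Type} {π : H → V}

section

variable [Fintype H]

@[simp]
theorem mem_pairings {s : Finset H} {P : Finset (Sym2 H)} : P ∈ pairings π s ↔ IsPairing π s P := by
  simp [pairings]

theorem pairings_empty : pairings π ∅ = {∅} := by
  ext P
  simp only [mem_pairings, Finset.mem_singleton]
  constructor
  · rintro ⟨-, h⟩
    refine Finset.eq_empty_of_forall_notMem fun p hp => ?_
    induction p with
    | h a b => exact absurd ((h _ hp).1 a (Sym2.mem_mk_left a b)) (by simp)
  · rintro rfl
    exact ⟨by simp, by simp⟩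

end

variable [DecidableEq H]

theorem IsPairing.insert_pair {s : Finset H} {h h' : H} {P : Finset (Sym2 H)} (hs : h ∉ s)
    (hh' : h' ∈ s) (hπ : π h' ≠ π h) (hP : IsPairing π (s.erase h') P) :
    IsPairing π (insert h s) (insert s(h, h') P) := by
  have notMem (k : H) (hk : k ∉ s.erase h') (p : Sym2 H) (hp : p ∈ P) : k ∉ p :=
    fun hkp => hk ((hP.2 p hp).1 k hkp)
  refine ⟨fun k hk => ?_, fun p hp => ?_⟩
  · by_cases hk' : k ∈ s.erase h'
    · obtain ⟨p, ⟨hp, hkp⟩, huniq⟩ := hP.1 k hk'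
      refine ⟨p, ⟨Finset.mem_insert_of_mem hp, hkp⟩, ?_⟩
      rintro q ⟨hq, hkq⟩
      rcases Finset.mem_insert.1 hq with rfl | hq
      · rw [Finset.mem_erase] at hk'
        rcases Sym2.mem_iff.1 hkq with rfl | rfl
        · exact absurd hk'.2 hs
        · exact absurd rfl hk'.1
      · exact huniq q ⟨hq, hkq⟩
    · have hk2 : k = h ∨ k = h' := by
        rcases Finset.mem_insert.1 hk with rfl | hk
        · exact Or.inl rfl
        · right
          by_contra hne
          exact hk' (Finset.mem_erase.2 ⟨hne, hk⟩)
      refine ⟨s(h, h'), ⟨Finset.mem_insert_self _ _, Sym2.mem_iff.2 hk2⟩, ?_⟩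
      rintro q ⟨hq, hkq⟩
      rcases Finset.mem_insert.1 hq with rfl | hq
      · rfl
      · exact absurd hkq (notMem k hk' q hq)
  · rcases Finset.mem_insert.1 hp with rfl | hp
    · refine ⟨fun k hk => ?_, ?_⟩
      · rcases Sym2.mem_iff.1 hk with rfl | rfl
        · exact Finset.mem_insert_self _ _
        · exact Finset.mem_insert_of_mem hh'
      · rw [Sym2.map_mk, Sym2.mk_isDiag_iff]
        exact fun e => hπ e.symm
    · exact ⟨fun k hk => Finset.mem_insert_of_mem (Finset.mem_of_mem_erase ((hP.2 p hp).1 k hk)),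
        (hP.2 p hp).2⟩

theorem IsPairing.exists_eq_insert {s : Finset H} {h : H} {P : Finset (Sym2 H)} (hs : h ∉ s)
    (hP : IsPairing π (insert h s) P) :
    ∃ h' ∈ s, π h' ≠ π h ∧ ∃ P', IsPairing π (s.erase h') P' ∧ insert s(h, h') P' = P := by
  obtain ⟨p, ⟨hp, hhp⟩, -⟩ := hP.1 h (Finset.mem_insert_self _ _)
  obtain ⟨h', rfl⟩ := Sym2.mem_iff_exists.1 hhp
  have hπ : π h' ≠ π h := by
    have := (hP.2 _ hp).2
    rw [Sym2.map_mk, Sym2.mk_isDiag_iff] at this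
    exact fun e => this e.symm
  have hne : h' ≠ h := fun e => hπ (by rw [e])
  have hmem : h' ∈ s :=
    Finset.mem_of_mem_insert_of_ne ((hP.2 _ hp).1 h' (Sym2.mem_mk_right _ _)) hne
  have huniq (k : H) (hk : k ∈ s(h, h')) (q : Sym2 H) (hq : q ∈ P) (hkq : k ∈ q) :
      q = s(h, h') :=
    (hP.1 k ((hP.2 _ hp).1 k hk)).unique ⟨hq, hkq⟩ ⟨hp, hk⟩
  refine ⟨h', hmem, hπ, P.erase s(h, h'), ⟨fun k hk => ?_, fun q hq => ?_⟩,
    Finset.insert_erase hp⟩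
  · obtain ⟨hk1, hk2⟩ := Finset.mem_erase.1 hk
    obtain ⟨q, ⟨hq, hkq⟩, hu⟩ := hP.1 k (Finset.mem_insert_of_mem hk2)
    refine ⟨q, ⟨Finset.mem_erase.2 ⟨?_, hq⟩, hkq⟩, ?_⟩
    · rintro rfl
      rcases Sym2.mem_iff.1 hkq with rfl | rfl
      · exact hs hk2
      · exact hk1 rfl
    · rintro r ⟨hr, hkr⟩
      exact hu r ⟨Finset.mem_of_mem_erase hr, hkr⟩
  · obtain ⟨hq1, hq2⟩ := Finset.mem_erase.1 hq
    refine ⟨fun k hk => ?_, (hP.2 q hq2).2⟩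
    have h1 : k ≠ h := by
      rintro rfl
      exact hq1 (huniq _ (Sym2.mem_mk_left _ _) q hq2 hk)
    have h2 : k ≠ h' := by
      rintro rfl
      exact hq1 (huniq _ (Sym2.mem_mk_right _ _) q hq2 hk)
    exact Finset.mem_erase.2 ⟨h2, Finset.mem_of_mem_insert_of_ne ((hP.2 q hq2).1 k hk) h1⟩

variable [Fintype H]

open Classical in
/-- Pairings are enumerated by choosing the partner of a given half-edge first. -/
theorem sum_pairings_insert {s : Finset H} {h : H} (hs : h ∉ s) (w : Sym2 H → ℝ) :
    ∑ P ∈ pairings π (insert h s), ∏ p ∈ P, w p =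
      ∑ h' ∈ s with π h' ≠ π h, w s(h, h') * ∑ P ∈ pairings π (s.erase h'), ∏ p ∈ P, w p := by
  simp_rw [Finset.mul_sum]
  rw [Finset.sum_sigma']
  have hnot {h' : H} {P : Finset (Sym2 H)} (hP : IsPairing π (s.erase h') P) (k : H) :
      s(h, k) ∉ P := fun hk =>
    hs (Finset.mem_of_mem_erase ((hP.2 _ hk).1 h (Sym2.mem_mk_left _ _)))
  symm
  refine Finset.sum_bij (fun q _ => insert s(h, q.1) q.2) ?_ ?_ ?_ ?_
  · rintro ⟨h', P⟩ hq
    simp only [Finset.mem_sigma, Finset.mem_filter, mem_pairings] at hq ⊢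
    exact hq.2.insert_pair hs hq.1.1 hq.1.2
  · rintro ⟨h₁, P₁⟩ hq₁ ⟨h₂, P₂⟩ hq₂ heq
    simp only [Finset.mem_sigma, Finset.mem_filter, mem_pairings] at hq₁ hq₂ heq
    have h1 : s(h, h₁) ∈ insert s(h, h₂) P₂ := heq ▸ Finset.mem_insert_self _ _
    have h2 : s(h, h₁) = s(h, h₂) := (Finset.mem_insert.1 h1).resolve_right (hnot hq₂.2 h₁)
    obtain rfl : h₁ = h₂ := Sym2.congr_right.1 h2
    have h3 : P₁ = P₂ := by
      rw [← Finset.erase_insert (hnot hq₁.2 h₁), heq, Finset.erase_insert (hnot hq₂.2 h₁)]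
    rw [h3]
  · intro P hP
    obtain ⟨h', hh', hπ, P', hP', rfl⟩ := (mem_pairings.1 hP).exists_eq_insert hs
    exact ⟨⟨h', P'⟩, by simp [hh', hπ, hP'], rfl⟩
  · rintro ⟨h', P⟩ hq
    simp only [Finset.mem_sigma, Finset.mem_filter, mem_pairings] at hq
    rw [Finset.prod_insert (hnot hq.2 h')]

end Pairings

section Wick

open Polynomial

variable {Ω : Type*} [MeasurableSpace Ω] {P : Measure Ω} [IsProbabilityMeasure P]
  {V H : Type} [Fintype V] [DecidableEq V] [Fintype H] [DecidableEq H]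

/-- The recursion for the moments of Hermite polynomials. The contraction of `Y u₀` with
itself in the integration by parts is cancelled by the recursion of the Hermite polynomials. -/
theorem integral_prod_hermitePoly_succ {Y : V → Ω → ℝ} (hY : IsGaussianProcess Y P)
    (hc : ∀ u, ∫ ω, Y u ω ∂P = 0) {v : ℝ} (hv : v ≠ 0) (hvar : ∀ u, ∫ ω, Y u ω * Y u ω ∂P = v)
    (d : V → ℕ) (u₀ : V) :
    ∫ ω, ∏ u, (hermitePoly v (d u + if u = u₀ then 1 else 0)).eval (Y u ω) ∂P =
      ∑ j ∈ Finset.univ.erase u₀, (∫ ω, Y u₀ ω * Y j ω ∂P) * (d j *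
        ∫ ω, ∏ u, (hermitePoly v (d u - if u = j then 1 else 0)).eval (Y u ω) ∂P) := by
  have hmem (u : V) (p : ℝ[X]) : (fun ω => p.eval (Y u ω)) ∈ momentAlgebra P :=
    polynomial_mem_momentAlgebra (hY.hasGaussianLaw_eval u).mem_momentAlgebra p
  let R (j : V) (p : ℝ[X]) (ω : Ω) : ℝ :=
    p.eval (Y j ω) * ∏ u ∈ Finset.univ.erase j, (hermitePoly v (d u)).eval (Y u ω)
  have hR (j : V) (p : ℝ[X]) : Integrable (R j p) P :=
    integrable_of_mem_momentAlgebra ((momentAlgebra P).mul_mem (hmem j p)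
      (prod_mem_momentAlgebra _ fun u _ => hmem u _))
  have hsplit (j : V) (e : V → ℕ) (he : ∀ u, u ≠ j → e u = d u) (ω : Ω) :
      ∏ u, (hermitePoly v (e u)).eval (Y u ω) = R j (hermitePoly v (e j)) ω := by
    rw [← Finset.mul_prod_erase _ _ (Finset.mem_univ j)]
    refine congrArg _ (Finset.prod_congr rfl fun u hu => ?_)
    rw [he u (Finset.ne_of_mem_erase hu)]
  have hstein := integral_mul_prod_eval_of_isGaussianProcess hY hc u₀ fun u => hermitePoly v (d u)
  rw [← Finset.add_sum_erase _ _ (Finset.mem_univ u₀), hvar] at hstein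
  have hlhs : ∫ ω, ∏ u, (hermitePoly v (d u + if u = u₀ then 1 else 0)).eval (Y u ω) ∂P =
      ∫ ω, Y u₀ ω * ∏ u, (hermitePoly v (d u)).eval (Y u ω) ∂P -
        v * ∫ ω, R u₀ (derivative (hermitePoly v (d u₀))) ω ∂P := by
    rw [← integral_const_mul, ← integral_sub]
    · refine integral_congr_ae (ae_of_all _ fun ω => ?_)
      simp only
      rw [hsplit u₀ _ (fun u hu => by simp [hu]), hsplit u₀ d (fun _ _ => rfl)]
      simp only [R, if_true, hermitePoly_succ hv, eval_sub, eval_mul, eval_X, eval_C]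
      ring
    · exact integrable_of_mem_momentAlgebra ((momentAlgebra P).mul_mem
        (hY.hasGaussianLaw_eval u₀).mem_momentAlgebra
        (prod_mem_momentAlgebra _ fun u _ => hmem u _))
    · exact (hR _ _).const_mul _
  rw [hlhs, hstein, add_sub_cancel_left]
  refine Finset.sum_congr rfl fun j _ => ?_
  congr 1
  rw [← integral_const_mul]
  refine integral_congr_ae (ae_of_all _ fun ω => ?_)
  simp only
  rw [hsplit j _ (fun u hu => by simp [hu]), derivative_hermitePoly hv]
  simp only [R, if_true, eval_mul, eval_natCast]
  ring

/-- **Wick's formula** for Hermite polynomials of a centred Gaussian vector with constant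
variance. -/
theorem integral_prod_hermitePoly {Y : V → Ω → ℝ} (hY : IsGaussianProcess Y P)
    (hc : ∀ u, ∫ ω, Y u ω ∂P = 0) {v : ℝ} (hvar : ∀ u, ∫ ω, Y u ω * Y u ω ∂P = v)
    (π : H → V) (w : Sym2 H → ℝ) (hw : ∀ h h', w s(h, h') = ∫ ω, Y (π h) ω * Y (π h') ω ∂P)
    (s : Finset H) :
    ∫ ω, ∏ u, (hermitePoly v (s.filter (π · = u)).card).eval (Y u ω) ∂P =
      ∑ Q ∈ pairings π s, ∏ p ∈ Q, w p := by
  induction hn : s.card using Nat.strong_induction_on generalizing s with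
  | _ n ih =>
  rcases s.eq_empty_or_nonempty with rfl | ⟨h, hh⟩
  · simp [pairings_empty, hermitePoly]
  obtain ⟨s, hs, rfl⟩ : ∃ s', h ∉ s' ∧ insert h s' = s :=
    ⟨s.erase h, Finset.notMem_erase _ _, Finset.insert_erase hh⟩
  have hcard : s.card < n := by
    rw [← hn, Finset.card_insert_of_notMem hs]
    exact Nat.lt_succ_self _
  have hins (u : V) : ((insert h s).filter (π · = u)).card =
      (s.filter (π · = u)).card + if u = π h then 1 else 0 := by
    rw [Finset.filter_insert]
    by_cases hu : π h = u
    · rw [if_pos hu, if_pos hu.symm, Finset.card_insert_of_notMem (by simp [hs])]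
    · rw [if_neg hu, if_neg (Ne.symm hu), add_zero]
  have herase (h' : H) (hh' : h' ∈ s) (u : V) : ((s.erase h').filter (π · = u)).card =
      (s.filter (π · = u)).card - if u = π h' then 1 else 0 := by
    rw [Finset.filter_erase]
    by_cases hu : π h' = u
    · rw [if_pos hu.symm, Finset.card_erase_of_mem (by simp [hh', hu])]
    · rw [if_neg (Ne.symm hu), Finset.erase_eq_of_notMem (by simp [hu]), Nat.sub_zero]
  rw [sum_pairings_insert hs]
  simp_rw [hins]
  -- For `v = 0` the process vanishes almost surely, and both sides are `0`.
  rcases eq_or_ne v 0 with rfl | hv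
  · rw [Finset.sum_eq_zero, integral_eq_zero_of_ae]
    · refine ae_of_all _ fun ω => ?_
      exact Finset.prod_eq_zero (Finset.mem_univ (π h)) (by simp [hermitePoly_zero_succ])
    · intro h' _
      rw [hw, integral_mul_eq_zero_of_integral_sq_eq_zero
        (hY.hasGaussianLaw_eval (π h)).memLp_two (hvar _), zero_mul]
  rw [integral_prod_hermitePoly_succ hY hc hv hvar]
  have hih : ∀ h' ∈ s, ∑ Q ∈ pairings π (s.erase h'), ∏ p ∈ Q, w p =
      ∫ ω, ∏ u, (hermitePoly v ((s.filter (π · = u)).card - if u = π h' then 1 else 0)).eval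
        (Y u ω) ∂P := by
    intro h' hh'
    rw [← ih _ ((Finset.card_erase_le).trans_lt hcard) (s.erase h') rfl]
    simp_rw [herase h' hh']
  rw [Finset.sum_filter, ← Finset.sum_fiberwise s π,
    ← Finset.add_sum_erase _ _ (Finset.mem_univ (π h)),
    Finset.sum_eq_zero (s := s.filter _), zero_add]
  · refine Finset.sum_congr rfl fun j hj => ?_
    rw [Finset.sum_congr rfl (g := fun _ => (∫ ω, Y (π h) ω * Y j ω ∂P) *
      ∫ ω, ∏ u, (hermitePoly v ((s.filter (π · = u)).card - if u = j then 1 else 0)).eval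
        (Y u ω) ∂P), Finset.sum_const, nsmul_eq_mul]
    · ring
    · intro h' hh'
      obtain ⟨hm, rfl⟩ := Finset.mem_filter.1 hh'
      rw [if_pos (Finset.ne_of_mem_erase hj), hih h' hm, hw]
  · intro h' hh'
    rw [if_neg]
    simpa using (Finset.mem_filter.1 hh').2

end Wick

/-! ### Moments as sums over pairings -/

/-- The integral attached to a pairing, over the positions in `Λ` of all vertices `V`: a factor
`K (x_u - x_v)` for each pair which joins the vertices `u` and `v`. -/
noncomputable def pairingValuation {Λ : Type*} [AddCommGroup Λ] [MeasurableSpace Λ] {H V : Type}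
    [Fintype V] (μ : Measure Λ) (K : Λ → ℝ) (hK : Function.Even K) (π : H → V)
    (Q : Finset (Sym2 H)) : ℝ :=
  ∫ x : V → Λ, ∏ p ∈ Q, edgeKernel K hK (p.map (x ∘ π)) ∂(Measure.pi fun _ => μ)

theorem eval_mem_momentAlgebra_prod {Λ Ω : Type*} [MeasurableSpace Λ] [MeasurableSpace Ω]
    {μ : Measure Λ} [IsFiniteMeasure μ] {P : Measure Ω} [IsProbabilityMeasure P] {X : Λ → Ω → ℝ}
    {V : Type} [Fintype V]
    (hX_meas : Measurable (Function.uncurry X))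
    (hX_gauss : IsGaussianProcess X P)
    (hX_centred : ∀ x, ∫ ω, X x ω ∂P = 0) {v : ℝ} (hX_var : ∀ x, Var[X x; P] = v) (u : V) :
    (fun q : Ω × (V → Λ) => X (q.2 u) q.1) ∈
      momentAlgebra (P.prod (Measure.pi fun _ : V => μ)) := by
  have hm : Measurable (fun q : Ω × (V → Λ) => X (q.2 u) q.1) := by
    have h := hX_meas.comp (((measurable_pi_apply (X := fun _ : V => Λ) u).comp
      (measurable_snd (α := Ω))).prodMk measurable_fst)
    exact h
  intro p hp
  rcases eq_or_ne p 0 with rfl | hp0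
  · exact memLp_zero_iff_aestronglyMeasurable.2 hm.aestronglyMeasurable
  refine ⟨hm.aestronglyMeasurable, ?_⟩
  rw [eLpNorm_lt_top_iff_lintegral_rpow_enorm_lt_top hp0 hp, lintegral_prod_symm _ (by fun_prop)]
  -- By stationarity the moments do not depend on the position.
  have hlaw (x : Λ) : ∫⁻ ω, ‖X x ω‖ₑ ^ p.toReal ∂P =
      ∫⁻ y, ‖y‖ₑ ^ p.toReal ∂(gaussianReal 0 v.toNNReal) := by
    have h := (hX_gauss.hasGaussianLaw_eval x).map_eq_gaussianReal
    rw [hX_centred, hX_var] at h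
    rw [← h, lintegral_map' (by fun_prop) (hX_gauss.aemeasurable x)]
  simp only [hlaw, lintegral_const]
  refine ENNReal.mul_lt_top ?_ (measure_lt_top _ _)
  have := (memLp_id_gaussianReal' (μ := 0) (v := v.toNNReal) p hp).2
  rwa [eLpNorm_lt_top_iff_lintegral_rpow_enorm_lt_top hp0 hp] at this

theorem abs_covariance_kernel_le {Λ Ω : Type*} [AddCommGroup Λ] [MeasurableSpace Ω]
    {P : Measure Ω} {K : Λ → ℝ} {X : Λ → Ω → ℝ} (hX_gauss : IsGaussianProcess X P)
    (hX_cov : ∀ x y, ∫ ω, X x ω * X y ω ∂P = K (x - y)) (x y : Λ) : |K (x - y)| ≤ K 0 := by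
  have hL2 (x : Λ) : MemLp (X x) 2 P := (hX_gauss.hasGaussianLaw_eval x).memLp_two
  have h0 (x : Λ) : ∫ ω, X x ω * X x ω ∂P = K 0 := by rw [hX_cov, sub_self]
  have hi (x : Λ) : Integrable (fun ω => X x ω * X x ω) P := (hL2 x).integrable_mul (hL2 x)
  calc |K (x - y)| = |∫ ω, X x ω * X y ω ∂P| := by rw [hX_cov]
    _ ≤ ∫ ω, |X x ω * X y ω| ∂P := abs_integral_le_integral_abs
    _ ≤ ∫ ω, (2 : ℝ)⁻¹ * (X x ω * X x ω + X y ω * X y ω) ∂P := by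
        refine integral_mono ((hL2 x).integrable_mul (hL2 y)).abs
          (((hi x).add (hi y)).const_mul _) fun ω => ?_
        simp only
        rw [abs_le]
        constructor <;> nlinarith [sq_nonneg (X x ω - X y ω), sq_nonneg (X x ω + X y ω)]
    _ = K 0 := by
        rw [integral_const_mul, integral_add (hi x) (hi y), h0, h0]
        ring

section Moment

variable {Λ Ω : Type*} [AddCommGroup Λ] [MeasurableSpace Λ] [MeasurableSpace Ω]
  {μ : Measure Λ} [IsFiniteMeasure μ] {P : Measure Ω} [IsProbabilityMeasure P]
  {K : Λ → ℝ} {hK : Function.Even K} {X : Λ → Ω → ℝ}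

theorem integrable_prod_edgeKernel {H V : Type} [Fintype V]
    (hX_meas : Measurable (Function.uncurry X)) (hX_gauss : IsGaussianProcess X P)
    (hX_cov : ∀ x y, ∫ ω, X x ω * X y ω ∂P = K (x - y)) (π : H → V) (Q : Finset (Sym2 H)) :
    Integrable (fun x : V → Λ => ∏ p ∈ Q, edgeKernel K hK (p.map (x ∘ π)))
      (Measure.pi fun _ => μ) := by
  have hm (p : Sym2 H) : Measurable fun x : V → Λ => edgeKernel K hK (p.map (x ∘ π)) := by
    induction p with
    | h a b =>
      have h1 : Measurable fun q : (V → Λ) × Ω => X (q.1 (π a)) q.2 * X (q.1 (π b)) q.2 := by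
        have (u : V) : Measurable fun q : (V → Λ) × Ω => X (q.1 u) q.2 := by
          have h := hX_meas.comp (((measurable_pi_apply (X := fun _ : V => Λ) u).comp
            (measurable_fst (β := Ω))).prodMk measurable_snd)
          exact h
        exact (this _).mul (this _)
      have h2 := (h1.stronglyMeasurable.integral_prod_right' (ν := P)).measurable
      simp only [hX_cov] at h2
      exact h2
  have hb (p : Sym2 H) (x : V → Λ) : ‖edgeKernel K hK (p.map (x ∘ π))‖ ≤ K 0 := by
    induction p with
    | h a b => exact abs_covariance_kernel_le hX_gauss hX_cov _ _
  refine Integrable.of_bound (Finset.measurable_prod _ fun p _ => hm p).aestronglyMeasurable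
    (∏ p ∈ Q, K 0) (ae_of_all _ fun x => ?_)
  rw [norm_prod]
  exact Finset.prod_le_prod (fun _ _ => norm_nonneg _) fun p _ => hb p x

open MultiIndex in
/-- The moment of a product of integrated Hermite polynomials is the sum of the integrals of all
pairings: Wick's formula is integrated over the positions of the vertices. -/
theorem moment_eq_sum_pairings (hX_meas : Measurable (Function.uncurry X))
    (hX_gauss : IsGaussianProcess X P)
    (hX_centred : ∀ x, ∫ ω, X x ω ∂P = 0)
    (hX_cov : ∀ x y, ∫ ω, X x ω * X y ω ∂P = K (x - y)) (β : ℕ →₀ ℕ) :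
    MultiIndex.moment μ P X β = ∑ Q ∈ pairings (Sigma.fst : HalfEdge β → Vertex β) Finset.univ,
      pairingValuation μ K hK (Sigma.fst : HalfEdge β → Vertex β) Q := by
  classical
  have hX_var (x : Λ) : Var[X x; P] = K 0 := by
    have hL2 : MemLp (X x) 2 P := (hX_gauss.hasGaussianLaw_eval x).memLp_two
    rw [← covariance_self (hX_gauss.aemeasurable x), covariance_eq_sub hL2 hL2, hX_centred]
    simp [hX_cov]
  have h1 (ω : Ω) : β.prod (fun k b => (∫ x, hermiteVar Var[X x; P] k (X x ω) ∂μ) ^ b) =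
      ∫ x : Vertex β → Λ, ∏ u, (hermitePoly (K 0) (u.1 : ℕ)).eval (X (x u) ω)
        ∂(Measure.pi fun _ => μ) := by
    rw [integral_fintype_prod_eq_prod
      (fun (u : Vertex β) (x : Λ) => (hermitePoly (K 0) (u.1 : ℕ)).eval (X x ω)),
      Fintype.prod_sigma, Finsupp.prod, ← Finset.prod_coe_sort]
    refine Finset.prod_congr rfl fun k _ => ?_
    simp only [Finset.prod_const, Finset.card_univ, Fintype.card_fin, hX_var, hermiteVar_eq_eval]
  have hcard (u : Vertex β) :
      ((Finset.univ : Finset (HalfEdge β)).filter (Sigma.fst · = u)).card = u.1 := by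
    rw [← Fintype.card_subtype, Fintype.card_congr (Equiv.sigmaSubtype u), Fintype.card_fin]
  unfold MultiIndex.moment
  simp_rw [h1]
  rw [integral_integral_swap]
  · have h2 (x : Vertex β → Λ) :
        ∫ ω, ∏ u, (hermitePoly (K 0) (u.1 : ℕ)).eval (X (x u) ω) ∂P =
          ∑ Q ∈ pairings (Sigma.fst : HalfEdge β → Vertex β) Finset.univ,
            ∏ p ∈ Q, edgeKernel K hK (p.map (x ∘ Sigma.fst)) := by
      rw [← integral_prod_hermitePoly (Y := fun u => X (x u)) (v := K 0) (hX_gauss.comp_right x)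
        (fun u => hX_centred _) (fun u => by rw [hX_cov, sub_self]) Sigma.fst
        (fun p => edgeKernel K hK (p.map (x ∘ Sigma.fst))) (fun h h' => (hX_cov _ _).symm)
        Finset.univ]
      simp_rw [hcard]
    simp_rw [h2]
    rw [integral_finsetSum _ fun Q _ => integrable_prod_edgeKernel hX_meas hX_gauss hX_cov _ _]
    rfl
  · exact integrable_of_mem_momentAlgebra (prod_mem_momentAlgebra _ fun u _ =>
      polynomial_mem_momentAlgebra
        (eval_mem_momentAlgebra_prod hX_meas hX_gauss hX_centred hX_var u) _)

end Moment

/-! ### Connected components of pairings -/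

/-- The graph on the vertices `V` formed by the pairs of `Q`. -/
def pairingGraph {H V : Type} (π : H → V) (Q : Finset (Sym2 H)) : SimpleGraph V :=
  SimpleGraph.fromEdgeSet (Sym2.map π '' Q)

open Classical in
/-- The pairings of all half-edges which connect all vertices. -/
noncomputable def connectedPairings {H V : Type} [Fintype H] (π : H → V) :
    Finset (Finset (Sym2 H)) :=
  (pairings π Finset.univ).filter fun Q => (pairingGraph π Q).Connected

section Components

variable {H V : Type} {π : H → V}

theorem mem_connectedPairings [Fintype H] {Q : Finset (Sym2 H)} :
    Q ∈ connectedPairings π ↔ IsPairing π Finset.univ Q ∧ (pairingGraph π Q).Connected := by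
  simp [connectedPairings]

theorem isPairing_univ_iff [Fintype H] {Q : Finset (Sym2 H)} : IsPairing π Finset.univ Q ↔
    (∀ a, ∃! b, s(a, b) ∈ Q) ∧ ∀ a b, s(a, b) ∈ Q → π a ≠ π b := by
  have h2 : (∀ p ∈ Q, (∀ h ∈ p, h ∈ Finset.univ) ∧ ¬ (p.map π).IsDiag) ↔
      ∀ a b, s(a, b) ∈ Q → π a ≠ π b := by
    simp only [Finset.mem_univ, implies_true, true_and, Sym2.forall, Sym2.map_mk,
      Sym2.mk_isDiag_iff, ne_eq]
  rw [IsPairing, h2]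
  refine and_congr_left fun _ => ?_
  simp only [Finset.mem_univ, true_implies]
  refine forall_congr' fun a => ⟨?_, ?_⟩
  · rintro ⟨p, ⟨hp, hap⟩, hu⟩
    obtain ⟨b, rfl⟩ := Sym2.mem_iff_exists.1 hap
    exact ⟨b, hp, fun c hc => Sym2.congr_right.1 (hu _ ⟨hc, Sym2.mem_mk_left _ _⟩)⟩
  · rintro ⟨b, hb, hu⟩
    refine ⟨s(a, b), ⟨hb, Sym2.mem_mk_left _ _⟩, ?_⟩
    rintro q ⟨hq, haq⟩
    obtain ⟨c, rfl⟩ := Sym2.mem_iff_exists.1 haq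
    rw [hu c hq]

theorem pairingGraph_adj {Q : Finset (Sym2 H)} {u v : V} :
    (pairingGraph π Q).Adj u v ↔ (∃ a b, s(a, b) ∈ Q ∧ π a = u ∧ π b = v) ∧ u ≠ v := by
  rw [pairingGraph, SimpleGraph.fromEdgeSet_adj]
  refine and_congr_left fun _ => ⟨?_, ?_⟩
  · rintro ⟨q, hq, hqe⟩
    induction q with
    | h a b =>
      rcases Sym2.eq_iff.1 hqe with ⟨h1, h2⟩ | ⟨h1, h2⟩
      · exact ⟨a, b, hq, h1, h2⟩
      · exact ⟨b, a, by rwa [Sym2.eq_swap], h2, h1⟩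
  · rintro ⟨a, b, hq, rfl, rfl⟩
    exact ⟨s(a, b), hq, rfl⟩

theorem reachable_iff_of_mem_pairs {Q : Finset (Sym2 H)} {u : V} {a b : H} (hab : s(a, b) ∈ Q) :
    (pairingGraph π Q).Reachable u (π a) ↔ (pairingGraph π Q).Reachable u (π b) := by
  by_cases he : π a = π b
  · rw [he]
  · have h : (pairingGraph π Q).Reachable (π a) (π b) :=
      SimpleGraph.Adj.reachable (pairingGraph_adj.2 ⟨⟨a, b, hab, rfl, rfl⟩, he⟩)
    exact ⟨fun h' => h'.trans h, fun h' => h'.trans h.symm⟩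

/-- The configuration `π` restricted to the vertices with the property `p` and to the half-edges
attached to them. -/
def restrictVertices (π : H → V) (p : V → Prop) : {h // p (π h)} → {v // p v} :=
  fun h => ⟨π h, h.2⟩

/-- The pairs of `Q` which join two half-edges in `r`. -/
def restrictPairs [Fintype H] [DecidableEq H] (r : H → Prop) [DecidablePred r]
    (Q : Finset (Sym2 H)) : Finset (Sym2 {h // r h}) :=
  Finset.univ.filter fun q => q.map Subtype.val ∈ Q

theorem mem_restrictPairs [Fintype H] [DecidableEq H] {r : H → Prop} [DecidablePred r]
    {Q : Finset (Sym2 H)} {a b : {h // r h}} :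
    s(a, b) ∈ restrictPairs r Q ↔ s(a.1, b.1) ∈ Q := by
  simp [restrictPairs]

/-- The union of a pairing of the half-edges in `r` and a pairing of the other half-edges. -/
def gluePairs [DecidableEq H] {r : H → Prop} (Q₁ : Finset (Sym2 {h // r h}))
    (Q₂ : Finset (Sym2 {h // ¬ r h})) : Finset (Sym2 H) :=
  Q₁.map (Function.Embedding.subtype r).sym2Map ∪
    Q₂.map (Function.Embedding.subtype fun h => ¬ r h).sym2Map

theorem mem_map_subtype {r : H → Prop} {Q : Finset (Sym2 {h // r h})} {a b : H} :
    s(a, b) ∈ Q.map (Function.Embedding.subtype r).sym2Map ↔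
      ∃ (ha : r a) (hb : r b), s(⟨a, ha⟩, ⟨b, hb⟩) ∈ Q := by
  rw [Finset.mem_map]
  constructor
  · rintro ⟨q, hq, hqe⟩
    induction q with
    | h x y =>
      rcases Sym2.eq_iff.1 (show s(x.1, y.1) = s(a, b) from hqe) with ⟨rfl, rfl⟩ | ⟨rfl, rfl⟩
      · exact ⟨x.2, y.2, hq⟩
      · exact ⟨y.2, x.2, by rwa [Sym2.eq_swap]⟩
  · rintro ⟨ha, hb, hq⟩
    exact ⟨_, hq, rfl⟩

theorem mem_gluePairs_iff_of_left [DecidableEq H] (r : H → Prop) {Q₁ : Finset (Sym2 {h // r h})}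
    {Q₂ : Finset (Sym2 {h // ¬ r h})} {a b : H} (ha : r a) :
    s(a, b) ∈ gluePairs Q₁ Q₂ ↔ ∃ hb : r b, s(⟨a, ha⟩, ⟨b, hb⟩) ∈ Q₁ := by
  rw [gluePairs, Finset.mem_union, mem_map_subtype, mem_map_subtype]
  constructor
  · rintro (⟨_, hb, h⟩ | ⟨h, _⟩)
    · exact ⟨hb, h⟩
    · exact absurd ha h
  · rintro ⟨hb, h⟩
    exact Or.inl ⟨ha, hb, h⟩

theorem mem_gluePairs_iff_of_right [DecidableEq H] (r : H → Prop) {Q₁ : Finset (Sym2 {h // r h})}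
    {Q₂ : Finset (Sym2 {h // ¬ r h})} {a b : H} (ha : ¬ r a) :
    s(a, b) ∈ gluePairs Q₁ Q₂ ↔ ∃ hb : ¬ r b, s(⟨a, ha⟩, ⟨b, hb⟩) ∈ Q₂ := by
  rw [gluePairs, Finset.mem_union, mem_map_subtype, mem_map_subtype]
  constructor
  · rintro (⟨h, _⟩ | ⟨_, hb, h⟩)
    · exact absurd h ha
    · exact ⟨hb, h⟩
  · rintro ⟨hb, h⟩
    exact Or.inr ⟨ha, hb, h⟩

theorem pairs_ext {Q Q' : Finset (Sym2 H)} (h : ∀ a b, s(a, b) ∈ Q ↔ s(a, b) ∈ Q') : Q = Q' := by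
  ext q
  induction q with
  | h a b => exact h a b

theorem reachable_gluePairs_iff [DecidableEq H] {p : V → Prop}
    {Q₁ : Finset (Sym2 {h // p (π h)})}
    {Q₂ : Finset (Sym2 {h // ¬ p (π h)})}
    (hconn : (pairingGraph (restrictVertices π p) Q₁).Connected) {u v : V} (hu : p u) :
    (pairingGraph π (gluePairs Q₁ Q₂)).Reachable u v ↔ p v := by
  constructor
  · rw [SimpleGraph.reachable_iff_reflTransGen]
    intro h
    induction h with
    | refl => exact hu
    | tail _ hadj ih =>
      obtain ⟨⟨a, b, hab, rfl, rfl⟩, -⟩ := pairingGraph_adj.1 hadj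
      exact ((mem_gluePairs_iff_of_left (fun h => p (π h)) ih).1 hab).1
  · intro hv
    have h := hconn.preconnected ⟨u, hu⟩ ⟨v, hv⟩
    refine h.map (G' := pairingGraph π (gluePairs Q₁ Q₂)) ⟨Subtype.val, ?_⟩
    intro x y hxy
    obtain ⟨⟨a, b, hab, rfl, rfl⟩, hne⟩ := pairingGraph_adj.1 hxy
    exact pairingGraph_adj.2 ⟨⟨a, b, (mem_gluePairs_iff_of_left (fun h => p (π h)) a.2).2
      ⟨b.2, hab⟩, rfl, rfl⟩,
      fun e => hne (Subtype.ext e)⟩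

variable [Fintype H] [DecidableEq H] {p : V → Prop} [DecidablePred p]

theorem restrictPairs_gluePairs_left {Q₁ : Finset (Sym2 {h // p (π h)})}
    {Q₂ : Finset (Sym2 {h // ¬ p (π h)})} :
    restrictPairs (fun h => p (π h)) (gluePairs Q₁ Q₂) = Q₁ := by
  refine pairs_ext fun a b => ?_
  rw [mem_restrictPairs, mem_gluePairs_iff_of_left (fun h => p (π h)) a.2]
  exact ⟨fun ⟨_, h⟩ => h, fun h => ⟨b.2, h⟩⟩

theorem restrictPairs_gluePairs_right {Q₁ : Finset (Sym2 {h // p (π h)})}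
    {Q₂ : Finset (Sym2 {h // ¬ p (π h)})} :
    restrictPairs (fun h => ¬ p (π h)) (gluePairs Q₁ Q₂) = Q₂ := by
  refine pairs_ext fun a b => ?_
  rw [mem_restrictPairs, mem_gluePairs_iff_of_right (fun h => p (π h)) a.2]
  exact ⟨fun ⟨_, h⟩ => h, fun h => ⟨b.2, h⟩⟩

theorem gluePairs_restrictPairs {Q : Finset (Sym2 H)}
    (hQ : ∀ a b, s(a, b) ∈ Q → (p (π a) ↔ p (π b))) :
    gluePairs (restrictPairs (fun h => p (π h)) Q) (restrictPairs (fun h => ¬ p (π h)) Q) = Q := by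
  refine pairs_ext fun a b => ?_
  by_cases ha : p (π a)
  · rw [mem_gluePairs_iff_of_left (fun h => p (π h)) ha]
    simp only [mem_restrictPairs]
    exact ⟨fun ⟨_, h⟩ => h, fun h => ⟨(hQ a b h).1 ha, h⟩⟩
  · rw [mem_gluePairs_iff_of_right (fun h => p (π h)) ha]
    simp only [mem_restrictPairs]
    exact ⟨fun ⟨_, h⟩ => h, fun h => ⟨fun hb => ha ((hQ a b h).2 hb), h⟩⟩

theorem IsPairing.glue {Q₁ : Finset (Sym2 {h // p (π h)})} {Q₂ : Finset (Sym2 {h // ¬ p (π h)})}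
    (h₁ : IsPairing (restrictVertices π p) Finset.univ Q₁)
    (h₂ : IsPairing (restrictVertices π fun v => ¬ p v) Finset.univ Q₂) :
    IsPairing π Finset.univ (gluePairs Q₁ Q₂) := by
  rw [isPairing_univ_iff] at h₁ h₂ ⊢
  refine ⟨fun a => ?_, fun a b => ?_⟩
  · by_cases ha : p (π a)
    · obtain ⟨b, hb, hu⟩ := h₁.1 ⟨a, ha⟩
      refine ⟨b, (mem_gluePairs_iff_of_left (fun h => p (π h)) ha).2 ⟨b.2, hb⟩, fun c hc => ?_⟩
      obtain ⟨hc', hc⟩ := (mem_gluePairs_iff_of_left (fun h => p (π h)) ha).1 hc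
      exact congrArg Subtype.val (hu ⟨c, hc'⟩ hc)
    · obtain ⟨b, hb, hu⟩ := h₂.1 ⟨a, ha⟩
      refine ⟨b, (mem_gluePairs_iff_of_right (fun h => p (π h)) ha).2 ⟨b.2, hb⟩, fun c hc => ?_⟩
      obtain ⟨hc', hc⟩ := (mem_gluePairs_iff_of_right (fun h => p (π h)) ha).1 hc
      exact congrArg Subtype.val (hu ⟨c, hc'⟩ hc)
  · by_cases ha : p (π a)
    · rw [mem_gluePairs_iff_of_left (fun h => p (π h)) ha]
      rintro ⟨hb, h⟩ he
      exact h₁.2 _ _ h (Subtype.ext he)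
    · rw [mem_gluePairs_iff_of_right (fun h => p (π h)) ha]
      rintro ⟨hb, h⟩ he
      exact h₂.2 _ _ h (Subtype.ext he)

theorem IsPairing.restrict {Q : Finset (Sym2 H)} (h : IsPairing π Finset.univ Q)
    (hQ : ∀ a b, s(a, b) ∈ Q → p (π a) → p (π b)) :
    IsPairing (restrictVertices π p) Finset.univ (restrictPairs (fun h => p (π h)) Q) := by
  rw [isPairing_univ_iff] at h ⊢
  refine ⟨fun a => ?_, fun a b hab he => ?_⟩
  · obtain ⟨b, hb, hu⟩ := h.1 a
    refine ⟨⟨b, hQ a b hb a.2⟩, mem_restrictPairs.2 hb, fun c hc => Subtype.ext ?_⟩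
    exact hu _ (mem_restrictPairs.1 hc)
  · exact h.2 _ _ (mem_restrictPairs.1 hab) (congrArg Subtype.val he)

theorem connected_restrictPairs {Q : Finset (Sym2 H)} {u : V}
    (hp : ∀ v, p v ↔ (pairingGraph π Q).Reachable u v) :
    (pairingGraph (restrictVertices π p) (restrictPairs (fun h => p (π h)) Q)).Connected := by
  have hu : p u := (hp u).2 (SimpleGraph.Reachable.refl _)
  have key (v : V) (hv : (pairingGraph π Q).Reachable u v) (hpv : p v) :
      (pairingGraph (restrictVertices π p) (restrictPairs (fun h => p (π h)) Q)).Reachable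
        ⟨u, hu⟩ ⟨v, hpv⟩ := by
    rw [SimpleGraph.reachable_iff_reflTransGen] at hv
    induction hv with
    | refl => exact SimpleGraph.Reachable.refl _
    | tail hr hadj ih =>
      have hpw := (hp _).2 ((SimpleGraph.reachable_iff_reflTransGen _ _).2 hr)
      refine (ih hpw).trans (SimpleGraph.Adj.reachable ?_)
      obtain ⟨⟨a, b, hab, rfl, rfl⟩, hne⟩ := pairingGraph_adj.1 hadj
      exact pairingGraph_adj.2 ⟨⟨⟨a, hpw⟩, ⟨b, hpv⟩, mem_restrictPairs.2 hab, rfl, rfl⟩,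
        fun e => hne (congrArg Subtype.val e)⟩
  have : Nonempty {v // p v} := ⟨⟨u, hu⟩⟩
  refine SimpleGraph.Connected.mk fun x y => ?_
  exact (key x ((hp _).1 x.2) x.2).symm.trans (key y ((hp _).1 y.2) y.2)

/-- A pairing is determined by the set `B` of vertices in the connected component of a vertex `u`,
the connected pairing which it induces on `B`, and the pairing which it induces on the complement
of `B`. -/
theorem sum_pairings_eq_sum_component [Fintype V] [DecidableEq V] (u : V)
    (F : Finset (Sym2 H) → ℝ) :
    ∑ Q ∈ pairings π Finset.univ, F Q = ∑ B : Finset V with u ∈ B,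
      ∑ Q₁ ∈ connectedPairings (restrictVertices π (· ∈ B)),
        ∑ Q₂ ∈ pairings (restrictVertices π fun v => ¬ v ∈ B) Finset.univ, F (gluePairs Q₁ Q₂) := by
  classical
  rw [← Finset.sum_fiberwise_of_maps_to (t := Finset.univ.filter fun B : Finset V => u ∈ B)
    (g := fun Q => Finset.univ.filter fun v => (pairingGraph π Q).Reachable u v)
    (fun Q _ => by simp)]
  refine Finset.sum_congr rfl fun B hB => ?_
  have huB : u ∈ B := by simpa using hB
  rw [← Finset.sum_product']
  symm
  refine Finset.sum_bij (fun q _ => gluePairs q.1 q.2) ?_ ?_ ?_ (fun _ _ => rfl)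
  · rintro ⟨Q₁, Q₂⟩ hq
    simp only [Finset.mem_product, mem_connectedPairings, mem_pairings] at hq
    simp only [Finset.mem_filter, mem_pairings]
    refine ⟨IsPairing.glue hq.1.1 hq.2, ?_⟩
    ext v
    simp only [Finset.mem_filter, Finset.mem_univ, true_and]
    exact reachable_gluePairs_iff hq.1.2 huB
  · rintro ⟨Q₁, Q₂⟩ - ⟨Q₁', Q₂'⟩ - he
    simp only at he
    have h1 := congrArg (restrictPairs fun h => π h ∈ B) he
    have h2 := congrArg (restrictPairs fun h => ¬ π h ∈ B) he
    rw [restrictPairs_gluePairs_left (p := (· ∈ B)),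
      restrictPairs_gluePairs_left (p := (· ∈ B))] at h1
    rw [restrictPairs_gluePairs_right (p := (· ∈ B)),
      restrictPairs_gluePairs_right (p := (· ∈ B))] at h2
    rw [h1, h2]
  · intro Q hQ
    simp only [Finset.mem_filter, mem_pairings] at hQ
    obtain ⟨hQ, hB'⟩ := hQ
    have hp (v : V) : v ∈ B ↔ (pairingGraph π Q).Reachable u v := by simp [← hB']
    have hcl (a b : H) (hab : s(a, b) ∈ Q) : π a ∈ B ↔ π b ∈ B := by
      rw [hp, hp]
      exact reachable_iff_of_mem_pairs hab
    refine ⟨(restrictPairs (fun h => π h ∈ B) Q, restrictPairs (fun h => ¬ π h ∈ B) Q), ?_,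
      gluePairs_restrictPairs (p := (· ∈ B)) hcl⟩
    simp only [Finset.mem_product, mem_connectedPairings, mem_pairings]
    exact ⟨⟨hQ.restrict (p := (· ∈ B)) fun a b hab => (hcl a b hab).1,
      connected_restrictPairs (p := (· ∈ B)) hp⟩,
      hQ.restrict (p := fun v => ¬ v ∈ B) fun a b hab => mt (hcl a b hab).2⟩

end Components

section Valuation

variable {Λ : Type*} [AddCommGroup Λ] [MeasurableSpace Λ] {μ : Measure Λ} [SigmaFinite μ]
  {K : Λ → ℝ} {hK : Function.Even K} {H V : Type} [Fintype V] {π : H → V}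

/-- The positions of the vertices with the property `p` and of the other vertices are integrated
independently. -/
theorem pairingValuation_gluePairs [DecidableEq H] {p : V → Prop} [DecidablePred p]
    (Q₁ : Finset (Sym2 {h // p (π h)})) (Q₂ : Finset (Sym2 {h // ¬ p (π h)})) :
    pairingValuation μ K hK π (gluePairs Q₁ Q₂) =
      pairingValuation μ K hK (restrictVertices π p) Q₁ *
        pairingValuation μ K hK (restrictVertices π fun v => ¬ p v) Q₂ := by
  have hdisj : Disjoint (Q₁.map (Function.Embedding.subtype fun h => p (π h)).sym2Map)
      (Q₂.map (Function.Embedding.subtype fun h => ¬ p (π h)).sym2Map) := by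
    rw [Finset.disjoint_left]
    intro q h1 h2
    induction q with
    | h a b => exact (mem_map_subtype.1 h2).1 (mem_map_subtype.1 h1).1
  unfold pairingValuation
  rw [← integral_prod_mul,
    ← (measurePreserving_piEquivPiSubtypeProd (fun _ : V => μ) p).integral_comp']
  congr 1
  funext x
  rw [gluePairs, Finset.prod_union hdisj, Finset.prod_map, Finset.prod_map]
  congr 1
  · refine Finset.prod_congr rfl fun q _ => ?_
    congr 1
    induction q with
    | h a b => rfl
  · refine Finset.prod_congr rfl fun q _ => ?_
    congr 1
    induction q with
    | h a b => rfl

theorem sum_pairingValuation_eq_sum_component [Fintype H] [DecidableEq H] [DecidableEq V] (u : V) :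
    ∑ Q ∈ pairings π Finset.univ, pairingValuation μ K hK π Q = ∑ B : Finset V with u ∈ B,
      (∑ Q ∈ connectedPairings (restrictVertices π (· ∈ B)),
        pairingValuation μ K hK (restrictVertices π (· ∈ B)) Q) *
      ∑ Q ∈ pairings (restrictVertices π fun v => ¬ v ∈ B) Finset.univ,
        pairingValuation μ K hK (restrictVertices π fun v => ¬ v ∈ B) Q := by
  rw [sum_pairings_eq_sum_component u]
  refine Finset.sum_congr rfl fun B _ => ?_
  rw [Finset.sum_mul_sum]
  refine Finset.sum_congr rfl fun Q₁ _ => Finset.sum_congr rfl fun Q₂ _ => ?_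
  convert pairingValuation_gluePairs (μ := μ) (K := K) (hK := hK) (p := (· ∈ B)) Q₁ Q₂

end Valuation

/-! ### Pairings up to relabelling -/

/-- A relabelling of the half-edges, on pairs. -/
def pairEquiv {H H' : Type} (e : H ≃ H') : Sym2 H ≃ Sym2 H' where
  toFun := Sym2.map e
  invFun := Sym2.map e.symm
  left_inv q := by simp [Sym2.map_map]
  right_inv q := by simp [Sym2.map_map]

section Relabel

variable {H V H' V' : Type} {π : H → V} {π' : H' → V'} {eV : V ≃ V'} {eH : H ≃ H'}

theorem mem_relabel {Q : Finset (Sym2 H)} {a b : H} :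
    s(eH a, eH b) ∈ (pairEquiv eH).finsetCongr Q ↔ s(a, b) ∈ Q := by
  rw [Equiv.finsetCongr_apply]
  exact Finset.mem_map' (pairEquiv eH).toEmbedding (a := s(a, b))

theorem isPairing_relabel_iff [Fintype H] [Fintype H'] (h : ∀ a, π' (eH a) = eV (π a))
    {Q : Finset (Sym2 H)} :
    IsPairing π' Finset.univ ((pairEquiv eH).finsetCongr Q) ↔ IsPairing π Finset.univ Q := by
  rw [isPairing_univ_iff, isPairing_univ_iff]
  refine and_congr ?_ ?_
  · refine (eH.forall_congr fun a => ?_).symm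
    exact eH.existsUnique_congr fun b => mem_relabel.symm
  · refine (eH.forall_congr fun a => eH.forall_congr fun b => ?_).symm
    rw [mem_relabel, h, h, eV.injective.ne_iff]

theorem connected_relabel_iff (h : ∀ a, π' (eH a) = eV (π a)) {Q : Finset (Sym2 H)} :
    (pairingGraph π' ((pairEquiv eH).finsetCongr Q)).Connected ↔ (pairingGraph π Q).Connected := by
  refine (SimpleGraph.Iso.connected_iff ⟨eV, fun {u v} => ?_⟩).symm
  rw [pairingGraph_adj, pairingGraph_adj]
  refine and_congr ?_ eV.injective.ne_iff
  refine (eH.exists_congr fun a => eH.exists_congr fun b => ?_).symm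
  rw [mem_relabel, h, h, eV.apply_eq_iff_eq, eV.apply_eq_iff_eq]

variable {Λ : Type*} [AddCommGroup Λ] [MeasurableSpace Λ] {μ : Measure Λ} [SigmaFinite μ]
  {K : Λ → ℝ} {hK : Function.Even K}

theorem pairingValuation_relabel [Fintype V] [Fintype V'] (h : ∀ a, π' (eH a) = eV (π a))
    (Q : Finset (Sym2 H)) :
    pairingValuation μ K hK π' ((pairEquiv eH).finsetCongr Q) = pairingValuation μ K hK π Q := by
  unfold pairingValuation
  rw [← (measurePreserving_piCongrLeft (fun _ : V' => μ) eV).integral_comp']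
  congr 1
  funext x
  rw [Equiv.finsetCongr_apply, Finset.prod_map]
  refine Finset.prod_congr rfl fun q _ => ?_
  congr 1
  change Sym2.map _ (Sym2.map eH q) = _
  rw [Sym2.map_map]
  congr 1
  funext a
  simp [h, MeasurableEquiv.coe_piCongrLeft, Equiv.piCongrLeft_apply_apply]

variable [Fintype H] [Fintype H'] [Fintype V] [Fintype V']

theorem sum_pairings_relabel (h : ∀ a, π' (eH a) = eV (π a)) :
    ∑ Q ∈ pairings π Finset.univ, pairingValuation μ K hK π Q =
      ∑ Q ∈ pairings π' Finset.univ, pairingValuation μ K hK π' Q :=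
  Finset.sum_equiv (pairEquiv eH).finsetCongr
    (fun Q => by rw [mem_pairings, mem_pairings, isPairing_relabel_iff h])
    fun Q _ => (pairingValuation_relabel h Q).symm

theorem sum_connectedPairings_relabel (h : ∀ a, π' (eH a) = eV (π a)) :
    ∑ Q ∈ connectedPairings π, pairingValuation μ K hK π Q =
      ∑ Q ∈ connectedPairings π', pairingValuation μ K hK π' Q :=
  Finset.sum_equiv (pairEquiv eH).finsetCongr
    (fun Q => by rw [mem_connectedPairings, mem_connectedPairings, isPairing_relabel_iff h,
      connected_relabel_iff h])
    fun Q _ => (pairingValuation_relabel h Q).symm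

end Relabel

/-! ### The recursion over the component of a vertex -/

namespace MultiIndex

theorem sum_single_apply {V : Type} (s : Finset V) (a : V → ℕ) (k : ℕ) :
    (∑ v ∈ s, Finsupp.single (a v) 1 : ℕ →₀ ℕ) k = (s.filter (a · = k)).card := by
  simp [Finsupp.finsetSum_apply, Finsupp.single_apply]

theorem exists_equiv_vertex {V : Type} [Fintype V] (a : V → ℕ) {γ : ℕ →₀ ℕ}
    (hγ : ∑ v, Finsupp.single (a v) 1 = γ) :
    ∃ eV : V ≃ Vertex γ, ∀ v, ((eV v).1 : ℕ) = a v := by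
  have hcard (k : ℕ) : γ k = Fintype.card {v // a v = k} := by
    rw [← hγ, sum_single_apply, Fintype.card_subtype]
  have hmem (v : V) : a v ∈ γ.support := by
    rw [Finsupp.mem_support_iff, hcard]
    have : Nonempty {w // a w = a v} := ⟨⟨v, rfl⟩⟩
    exact Fintype.card_ne_zero
  let f : V → γ.support := fun v => ⟨a v, hmem v⟩
  have e (k : γ.support) : {v // f v = k} ≃ Fin (γ k) :=
    (Equiv.subtypeEquivRight fun v => Subtype.ext_iff).trans
      (Fintype.equivFinOfCardEq (hcard k).symm)
  exact ⟨(Equiv.sigmaFiberEquiv f).symm.trans (Equiv.sigmaCongrRight e), fun v => rfl⟩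

theorem exists_equiv_halfEdge {H V : Type} [Fintype H] [Fintype V] [DecidableEq V] (π : H → V)
    {γ : ℕ →₀ ℕ} (hγ : ∑ v, Finsupp.single (Fintype.card {h // π h = v}) 1 = γ) :
    ∃ (eV : V ≃ Vertex γ) (eH : H ≃ HalfEdge γ), ∀ h, (eH h).1 = eV (π h) := by
  obtain ⟨eV, heV⟩ := exists_equiv_vertex _ hγ
  have F (v : V) : {h // π h = v} ≃ Fin ((eV v).1 : ℕ) := Fintype.equivFinOfCardEq (heV v).symm
  exact ⟨eV, (Equiv.sigmaFiberEquiv π).symm.trans (Equiv.sigmaCongr eV F), fun h => rfl⟩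

section

variable {Λ : Type*} [AddCommGroup Λ] [MeasurableSpace Λ] (μ : Measure Λ)
  (K : Λ → ℝ) (hK : Function.Even K)

/-- The sum of the integrals of all pairings of the half-edges of `z^γ`. -/
noncomputable def pairingSum (γ : ℕ →₀ ℕ) : ℝ :=
  ∑ Q ∈ pairings (Sigma.fst : HalfEdge γ → Vertex γ) Finset.univ,
    pairingValuation μ K hK (Sigma.fst : HalfEdge γ → Vertex γ) Q

/-- The sum of the integrals of the connected pairings of the half-edges of `z^γ`. -/
noncomputable def connectedPairingSum (γ : ℕ →₀ ℕ) : ℝ :=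
  ∑ Q ∈ connectedPairings (Sigma.fst : HalfEdge γ → Vertex γ),
    pairingValuation μ K hK (Sigma.fst : HalfEdge γ → Vertex γ) Q

end

/-- The multi-index formed by the vertices in `B`. -/
noncomputable def ofVertices {β : ℕ →₀ ℕ} (B : Finset (Vertex β)) : ℕ →₀ ℕ :=
  ∑ u ∈ B, Finsupp.single (u.1 : ℕ) 1

theorem ofVertices_univ (β : ℕ →₀ ℕ) : ofVertices (Finset.univ : Finset (Vertex β)) = β := by
  rw [ofVertices, Fintype.sum_sigma]
  conv_rhs => rw [← Finsupp.sum_single β, Finsupp.sum, ← Finset.sum_coe_sort]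
  simp

theorem ofVertices_add_compl {β : ℕ →₀ ℕ} [DecidableEq (Vertex β)] (B : Finset (Vertex β)) :
    ofVertices B + ofVertices Bᶜ = β := by
  conv_rhs => rw [← ofVertices_univ β]
  exact Finset.sum_add_sum_compl _ _

theorem ofVertices_le {β : ℕ →₀ ℕ} (B : Finset (Vertex β)) : ofVertices B ≤ β := by
  classical
  conv_rhs => rw [← ofVertices_add_compl B]
  exact le_self_add

/-- The number of sets of vertices which form the multi-index `γ`. -/
theorem card_ofVertices_eq {β γ : ℕ →₀ ℕ} (hγ : γ ≤ β) :
    (Finset.univ.filter fun B : Finset (Vertex β) => ofVertices B = γ).card =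
      β.prod fun k b => b.choose (γ k) := by
  classical
  have h1 : (β.prod fun k b => b.choose (γ k)) =
      (Fintype.piFinset fun k : β.support =>
        Finset.powersetCard (γ k) (Finset.univ : Finset (Fin (β k)))).card := by
    simp [Fintype.card_piFinset, Finsupp.prod, Finset.prod_attach β.support
      (fun k => (β k).choose (γ k))]
  have h2 (t : ∀ k : β.support, Finset (Fin (β k))) (k : β.support) :
      ofVertices (Finset.univ.sigma t) k = (t k).card := by
    rw [ofVertices, Finset.sum_sigma, Finsupp.finsetSum_apply, Finset.sum_eq_single k]
    · simp
    · intro l _ hl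
      have : (l : ℕ) ≠ k := fun e => hl (Subtype.ext e)
      simp [this]
    · simp
  rw [h1]
  symm
  refine Finset.card_bij (fun t _ => Finset.univ.sigma t) ?_ ?_ ?_
  · intro t ht
    simp only [Fintype.mem_piFinset, Finset.mem_powersetCard, Finset.subset_univ, true_and] at ht
    simp only [Finset.mem_filter, Finset.mem_univ, true_and]
    ext k
    by_cases hk : k ∈ β.support
    · exact (h2 t ⟨k, hk⟩).trans (ht ⟨k, hk⟩)
    · have hk0 : β k = 0 := Finsupp.notMem_support_iff.1 hk
      have h3 := ofVertices_le (Finset.univ.sigma t) k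
      have h4 := hγ k
      omega
  · intro t _ t' _ h
    funext k
    ext i
    have := congrArg (fun B : Finset (Vertex β) => (⟨k, i⟩ : Vertex β) ∈ B) h
    simpa using this
  · intro B hB
    have hB' : Finset.univ.sigma (fun k : β.support =>
        (Finset.univ : Finset (Fin (β k))).filter fun i => (⟨k, i⟩ : Vertex β) ∈ B) = B := by
      ext u
      simp
    refine ⟨_, ?_, hB'⟩
    simp only [Fintype.mem_piFinset, Finset.mem_powersetCard, Finset.subset_univ, true_and]
    intro k
    refine (h2 (fun k => Finset.univ.filter fun i => (⟨k, i⟩ : Vertex β) ∈ B) k).symm.trans ?_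
    rw [hB']
    simp only [Finset.mem_filter, Finset.mem_univ, true_and] at hB
    rw [hB]

section

variable {Λ : Type*} [AddCommGroup Λ] [MeasurableSpace Λ] {μ : Measure Λ} [SigmaFinite μ]
  {K : Λ → ℝ} {hK : Function.Even K}

theorem sum_single_card_restrictVertices {β : ℕ →₀ ℕ} [DecidableEq (Vertex β)]
    (p : Vertex β → Prop) [DecidablePred p] [Fintype {u // p u}] :
    ∑ u : {u : Vertex β // p u}, Finsupp.single (Fintype.card
        {h // restrictVertices (Sigma.fst : HalfEdge β → Vertex β) p h = u}) 1 =
      ofVertices (Finset.univ.filter p) := by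
  have h1 (u : {u : Vertex β // p u}) : Fintype.card
      {h // restrictVertices (Sigma.fst : HalfEdge β → Vertex β) p h = u} = (u.1.1 : ℕ) := by
    let e : {h // restrictVertices (Sigma.fst : HalfEdge β → Vertex β) p h = u} ≃
        {h : HalfEdge β // h.1 = u.1} :=
      { toFun := fun h => ⟨h.1.1, congrArg Subtype.val h.2⟩
        invFun := fun h => ⟨⟨h.1, by rw [h.2]; exact u.2⟩, Subtype.ext h.2⟩
        left_inv := fun _ => rfl
        right_inv := fun _ => rfl }
    rw [Fintype.card_congr (e.trans (Equiv.sigmaSubtype u.1)), Fintype.card_fin]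
  simp_rw [h1]
  rw [ofVertices]
  exact (Finset.sum_subtype _ (by simp) fun u : Vertex β => Finsupp.single (u.1 : ℕ) 1).symm

theorem pairingSum_eq_sum_component {β : ℕ →₀ ℕ} (u : Vertex β) :
    pairingSum μ K hK β = ∑ B : Finset (Vertex β) with u ∈ B,
      connectedPairingSum μ K hK (ofVertices B) * pairingSum μ K hK (β - ofVertices B) := by
  classical
  rw [pairingSum, sum_pairingValuation_eq_sum_component u]
  refine Finset.sum_congr rfl fun B _ => ?_
  have hB : Finset.univ.filter (· ∈ B) = B := by ext; simp
  have hBc : Finset.univ.filter (fun v => ¬ v ∈ B) = Bᶜ := by ext; simp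
  congr 1
  · obtain ⟨eV, eH, h⟩ := exists_equiv_halfEdge
      (restrictVertices (Sigma.fst : HalfEdge β → Vertex β) (· ∈ B))
      ((sum_single_card_restrictVertices (· ∈ B)).trans (congrArg _ hB))
    exact sum_connectedPairings_relabel h
  · have hsub : ofVertices Bᶜ = β - ofVertices B := by
      rw [eq_tsub_iff_add_eq_of_le (ofVertices_le B), add_comm]
      exact ofVertices_add_compl B
    obtain ⟨eV, eH, h⟩ := exists_equiv_halfEdge
      (restrictVertices (Sigma.fst : HalfEdge β → Vertex β) fun v => ¬ v ∈ B)
      ((sum_single_card_restrictVertices fun v => ¬ v ∈ B).trans ((congrArg _ hBc).trans hsub))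
    exact sum_pairings_relabel h

/-- The recursion `z_k ∂_k E = (z_k ∂_k C) E` between the exponential generating functions of all
pairings and of the connected ones: sum over all vertices of arity `k` and their components. -/
theorem mul_pairingSum (β : ℕ →₀ ℕ) (k : ℕ) :
    β k * pairingSum μ K hK β = ∑ γ ∈ Finset.Iic β, ((β.prod fun l b => b.choose (γ l) : ℕ) : ℝ) *
      (γ k * (connectedPairingSum μ K hK γ * pairingSum μ K hK (β - γ))) := by
  classical
  have h1 : (β k : ℝ) * pairingSum μ K hK β =
      ∑ u : Vertex β with (u.1 : ℕ) = k, pairingSum μ K hK β := by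
    rw [Finset.sum_const, nsmul_eq_mul]
    congr 2
    conv_lhs => rw [← ofVertices_univ β]
    exact sum_single_apply _ _ _
  rw [h1]
  calc ∑ u : Vertex β with (u.1 : ℕ) = k, pairingSum μ K hK β
      = ∑ u : Vertex β with (u.1 : ℕ) = k, ∑ B : Finset (Vertex β) with u ∈ B,
          connectedPairingSum μ K hK (ofVertices B) * pairingSum μ K hK (β - ofVertices B) :=
        Finset.sum_congr rfl fun u _ => pairingSum_eq_sum_component u
    _ = ∑ B : Finset (Vertex β), ∑ u ∈ B with (u.1 : ℕ) = k,
          connectedPairingSum μ K hK (ofVertices B) * pairingSum μ K hK (β - ofVertices B) :=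
        Finset.sum_comm' (by simp [and_comm])
    _ = ∑ B : Finset (Vertex β), (ofVertices B k : ℝ) *
          (connectedPairingSum μ K hK (ofVertices B) * pairingSum μ K hK (β - ofVertices B)) := by
        refine Finset.sum_congr rfl fun B _ => ?_
        rw [Finset.sum_const, nsmul_eq_mul]
        congr 2
        exact (sum_single_apply _ _ _).symm
    _ = _ := by
        rw [← Finset.sum_fiberwise_of_maps_to (t := Finset.Iic β) (g := ofVertices)
          (fun B _ => Finset.mem_Iic.2 (ofVertices_le B))]
        refine Finset.sum_congr rfl fun γ hγ => ?_
        rw [← card_ofVertices_eq (Finset.mem_Iic.1 hγ), ← nsmul_eq_mul, ← Finset.sum_const]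
        refine Finset.sum_congr rfl fun B hB => ?_
        rw [(Finset.mem_filter.1 hB).2]

end

end MultiIndex

/-! ### The recursion over forests of multi-indices -/

namespace MultiIndex

theorem multinomial_eq_one_of_forall_eq_zero {m : Multiset ℕ} (h : ∀ x ∈ m, x = 0) :
    m.multinomial = 1 := by
  induction m using Multiset.induction_on with
  | empty => rfl
  | cons x m ih =>
    rw [Multiset.multinomial_cons, h x (Multiset.mem_cons_self _ _),
      ih fun y hy => h y (Multiset.mem_cons_of_mem hy)]
    simp

theorem prod_multinomial_of_support_subset {f : Multiset (ℕ →₀ ℕ)} {s : Finset ℕ}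
    (hs : f.sum.support ⊆ s) :
    ∏ k ∈ f.sum.support, ((f.map fun γ => γ k).multinomial : ℝ) =
      ∏ k ∈ s, ((f.map fun γ => γ k).multinomial : ℝ) := by
  refine Finset.prod_subset hs fun k _ hk => ?_
  rw [multinomial_eq_one_of_forall_eq_zero, Nat.cast_one]
  intro x hx
  obtain ⟨γ, hγ, rfl⟩ := Multiset.mem_map.1 hx
  have h1 := Multiset.single_le_sum (fun _ _ => zero_le) γ hγ k
  have h2 : f.sum k = 0 := Finsupp.notMem_support_iff.1 hk
  omega

/-- The groups of type `γ` in a splitting into `z^γ` and the forest `f` are not ordered, so that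
each splitting is obtained `f.count γ + 1` times by splitting off a group of type `γ`. -/
theorem splitCount_cons [DecidableEq (ℕ →₀ ℕ)] (γ : ℕ →₀ ℕ) (f : Multiset (ℕ →₀ ℕ)) :
    ((f.count γ : ℝ) + 1) * splitCount (γ ::ₘ f) =
      (((γ + f.sum).prod fun k b => b.choose (γ k) : ℕ) : ℝ) * splitCount f := by
  have hnum : ∏ k ∈ (γ ::ₘ f).sum.support, (((γ ::ₘ f).map fun δ => δ k).multinomial : ℝ) =
      (((γ + f.sum).prod fun k b => b.choose (γ k) : ℕ) : ℝ) *
        ∏ k ∈ f.sum.support, ((f.map fun δ => δ k).multinomial : ℝ) := by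
    rw [prod_multinomial_of_support_subset (f := f) (s := (γ + f.sum).support)
      (Finsupp.support_mono le_add_self), Multiset.sum_cons, Finsupp.prod, Nat.cast_prod,
      ← Finset.prod_mul_distrib]
    refine Finset.prod_congr rfl fun k _ => ?_
    rw [Multiset.map_cons, Multiset.multinomial_cons, Nat.cast_mul]
    congr 3
    rw [Finsupp.add_apply]
    congr 1
    exact (map_multiset_sum (Finsupp.applyAddHom k) f).symm
  have hden : ∏ δ ∈ (γ ::ₘ f).toFinset, (((γ ::ₘ f).count δ)! : ℝ) =
      ((f.count γ : ℝ) + 1) * ∏ δ ∈ f.toFinset, ((f.count δ)! : ℝ) := by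
    have h1 : ∏ δ ∈ f.toFinset, ((f.count δ)! : ℝ) =
        ∏ δ ∈ (γ ::ₘ f).toFinset, ((f.count δ)! : ℝ) := by
      refine Finset.prod_subset (by simp) fun δ _ hδ => ?_
      rw [Multiset.count_eq_zero_of_notMem (by simpa using hδ)]
      simp
    have hmem : γ ∈ (γ ::ₘ f).toFinset := by simp
    rw [h1, ← Finset.mul_prod_erase _ _ hmem, ← Finset.mul_prod_erase _ _ hmem,
      Multiset.count_cons_self, Nat.factorial_succ]
    push_cast
    rw [mul_assoc]
    congr 2
    refine Finset.prod_congr rfl fun δ hδ => ?_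
    rw [Multiset.count_cons_of_ne (Finset.ne_of_mem_erase hδ)]
  have hinst : splitCount (γ ::ₘ f) =
      (∏ k ∈ (γ ::ₘ f).sum.support, (((γ ::ₘ f).map fun δ => δ k).multinomial : ℝ)) /
        ∏ δ ∈ (γ ::ₘ f).toFinset, (((γ ::ₘ f).count δ)! : ℝ) := by
    unfold splitCount
    congr!
  have hinst' : splitCount f =
      (∏ k ∈ f.sum.support, ((f.map fun δ => δ k).multinomial : ℝ)) /
        ∏ δ ∈ f.toFinset, ((f.count δ)! : ℝ) := by
    unfold splitCount
    congr!
  have hne : ∏ δ ∈ f.toFinset, ((f.count δ)! : ℝ) ≠ 0 :=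
    Finset.prod_ne_zero_iff.2 fun δ _ => by positivity
  have hne' : (f.count γ : ℝ) + 1 ≠ 0 := by positivity
  rw [hinst, hinst', hnum, hden]
  field_simp

theorem splitCount_zero : splitCount 0 = 1 := by
  simp [splitCount]

theorem splitCount_singleton (β : ℕ →₀ ℕ) : splitCount {β} = 1 := by
  simp [splitCount]

theorem finite_forests (β : ℕ →₀ ℕ) :
    {f : Multiset (ℕ →₀ ℕ) | (∀ γ ∈ f, γ ∈ admissible) ∧ f.sum = β}.Finite := by
  refine ((finite_splittings β).union (Set.toFinite {0, {β}})).subset ?_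
  rintro f ⟨hf, hsum⟩
  by_cases hcard : 2 ≤ Multiset.card f
  · exact Or.inl ⟨hcard, hf, hsum⟩
  · right
    rcases Nat.lt_or_ge (Multiset.card f) 1 with h | h
    · exact Or.inl (Multiset.card_eq_zero.1 (by omega))
    · obtain ⟨γ, rfl⟩ := Multiset.card_eq_one.1 (show Multiset.card f = 1 by omega)
      rw [Multiset.sum_singleton] at hsum
      exact Or.inr (by rw [hsum]; rfl)

/-- The forests of any number of multi-indices in `𝐌` which sum up to `β`. -/
noncomputable def forests (β : ℕ →₀ ℕ) : Finset (Multiset (ℕ →₀ ℕ)) := (finite_forests β).toFinset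

theorem mem_forests {β : ℕ →₀ ℕ} {f : Multiset (ℕ →₀ ℕ)} :
    f ∈ forests β ↔ (∀ γ ∈ f, γ ∈ admissible) ∧ f.sum = β := by
  simp [forests]

theorem forests_zero : forests 0 = {0} := by
  ext f
  rw [mem_forests, Finset.mem_singleton]
  constructor
  · rintro ⟨hf, hsum⟩
    refine Multiset.eq_zero_of_forall_notMem fun γ hγ => ne_zero_of_admissible (hf γ hγ) ?_
    exact le_antisymm (hsum ▸ Multiset.single_le_sum (fun _ _ => zero_le) γ hγ) zero_le
  · rintro rfl
    simp

/-- The weighted sum over all forests, including those of a single multi-index. -/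
noncomputable def forestSum (c : (ℕ →₀ ℕ) → ℝ) (β : ℕ →₀ ℕ) : ℝ :=
  ∑ f ∈ forests β, splitCount f * (f.map c).prod

theorem forestSum_zero (c : (ℕ →₀ ℕ) → ℝ) : forestSum c 0 = 1 := by
  simp [forestSum, forests_zero, splitCount_zero]

theorem forestSum_eq_add {c : (ℕ →₀ ℕ) → ℝ} (hc : ∀ γ, γ ∉ admissible → c γ = 0) {β : ℕ →₀ ℕ}
    (hβ : β ≠ 0) :
    forestSum c β = c β + ∑ f ∈ splittings β, splitCount f * (f.map c).prod := by
  classical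
  have hnot : {β} ∉ splittings β := by
    rw [mem_splittings]
    rintro ⟨h, -⟩
    simp at h
  have h1 : forests β ⊆ insert {β} (splittings β) := by
    intro f hf
    obtain ⟨hf, hsum⟩ := mem_forests.1 hf
    rw [Finset.mem_insert, mem_splittings]
    by_cases hcard : 2 ≤ Multiset.card f
    · exact Or.inr ⟨hcard, hf, hsum⟩
    · left
      rcases Nat.lt_or_ge (Multiset.card f) 1 with h | h
      · obtain rfl := Multiset.card_eq_zero.1 (show Multiset.card f = 0 by omega)
        exact absurd hsum.symm hβ
      · obtain ⟨γ, rfl⟩ := Multiset.card_eq_one.1 (show Multiset.card f = 1 by omega)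
        rw [← hsum, Multiset.sum_singleton]
  rw [forestSum, Finset.sum_subset h1, Finset.sum_insert hnot, splitCount_singleton]
  · simp
  · intro f hf hf'
    rw [Finset.mem_insert, mem_splittings] at hf
    rcases hf with rfl | hf
    · have : β ∉ admissible := fun h => hf' (mem_forests.2 ⟨by simpa using h, by simp⟩)
      simp [hc β this]
    · exact absurd (mem_forests.2 hf.2) hf'

theorem sum_apply_eq_sum_count [DecidableEq (ℕ →₀ ℕ)] (f : Multiset (ℕ →₀ ℕ)) (k : ℕ) :
    f.sum k = ∑ γ ∈ f.toFinset, f.count γ * γ k := by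
  rw [Finset.sum_multiset_count, Finsupp.finsetSum_apply]
  simp

/-- The sum over all forests obeys the recursion `mul_pairingSum`: a multi-index of the forest is
split off. -/
theorem mul_forestSum {c : (ℕ →₀ ℕ) → ℝ} (hc : ∀ γ, γ ∉ admissible → c γ = 0) (β : ℕ →₀ ℕ)
    (k : ℕ) :
    β k * forestSum c β = ∑ γ ∈ Finset.Iic β, ((β.prod fun l b => b.choose (γ l) : ℕ) : ℝ) *
      (γ k * (c γ * forestSum c (β - γ))) := by
  classical
  have hl : β k * forestSum c β = ∑ f ∈ forests β, ∑ γ ∈ f.toFinset,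
      (f.count γ * splitCount f) * (γ k * (f.map c).prod) := by
    rw [forestSum, Finset.mul_sum]
    refine Finset.sum_congr rfl fun f hf => ?_
    rw [← (mem_forests.1 hf).2, sum_apply_eq_sum_count, Nat.cast_sum, Finset.sum_mul]
    refine Finset.sum_congr rfl fun γ _ => ?_
    push_cast
    ring
  have hr : ∑ γ ∈ Finset.Iic β, ((β.prod fun l b => b.choose (γ l) : ℕ) : ℝ) *
      (γ k * (c γ * forestSum c (β - γ))) =
      ∑ γ ∈ Finset.Iic β with γ ∈ admissible, ∑ f ∈ forests (β - γ),
        (((β.prod fun l b => b.choose (γ l) : ℕ) : ℝ) * splitCount f) *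
          (γ k * (c γ * (f.map c).prod)) := by
    rw [Finset.sum_filter]
    refine Finset.sum_congr rfl fun γ _ => ?_
    split_ifs with h
    · rw [forestSum]
      simp only [Finset.mul_sum]
      refine Finset.sum_congr rfl fun f _ => ?_
      ring
    · simp [hc γ h]
  rw [hl, hr, Finset.sum_sigma', Finset.sum_sigma']
  refine Finset.sum_bij' (fun q _ => ⟨q.2, q.1.erase q.2⟩) (fun q _ => ⟨q.1 ::ₘ q.2, q.1⟩)
    ?_ ?_ ?_ ?_ ?_
  · rintro ⟨f, γ⟩ hq
    simp only [Finset.mem_sigma, mem_forests, Multiset.mem_toFinset, Finset.mem_filter,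
      Finset.mem_Iic] at hq ⊢
    obtain ⟨⟨hf, rfl⟩, hγ⟩ := hq
    have hle : γ ≤ f.sum := Multiset.single_le_sum (fun _ _ => zero_le) γ hγ
    refine ⟨⟨hle, hf γ hγ⟩, fun δ hδ => hf δ (Multiset.mem_of_mem_erase hδ), ?_⟩
    rw [eq_tsub_iff_add_eq_of_le hle, add_comm, Multiset.sum_erase hγ]
  · rintro ⟨γ, f⟩ hq
    simp only [Finset.mem_sigma, mem_forests, Multiset.mem_toFinset, Finset.mem_filter,
      Finset.mem_Iic] at hq ⊢
    obtain ⟨⟨hle, hγ⟩, hf, hsum⟩ := hq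
    refine ⟨⟨?_, ?_⟩, Multiset.mem_cons_self _ _⟩
    · simpa using ⟨hγ, hf⟩
    · rw [Multiset.sum_cons, hsum, add_tsub_cancel_of_le hle]
  · rintro ⟨f, γ⟩ hq
    simp only [Finset.mem_sigma, Multiset.mem_toFinset] at hq
    simp [Multiset.cons_erase hq.2]
  · rintro ⟨γ, f⟩ -
    simp
  · rintro ⟨f, γ⟩ hq
    simp only [Finset.mem_sigma, mem_forests, Multiset.mem_toFinset] at hq
    obtain ⟨⟨-, rfl⟩, hγ⟩ := hq
    obtain ⟨g, rfl⟩ := Multiset.exists_cons_of_mem hγ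
    have h := splitCount_cons γ g
    simp only [Multiset.erase_cons_head, Multiset.count_cons_self, Multiset.map_cons,
      Multiset.prod_cons, Multiset.sum_cons, Nat.cast_add, Nat.cast_one]
    rw [h]

/-- A function with the recursion of `mul_forestSum` agrees with `forestSum`. -/
theorem eq_forestSum {c E : (ℕ →₀ ℕ) → ℝ} (hc : ∀ γ, γ ∉ admissible → c γ = 0) (h0 : E 0 = 1)
    (hE : ∀ β k, (β k : ℝ) * E β =
      ∑ γ ∈ Finset.Iic β, ((β.prod fun l b => b.choose (γ l) : ℕ) : ℝ) *
        (γ k * (c γ * E (β - γ)))) (β : ℕ →₀ ℕ) :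
    E β = forestSum c β := by
  induction hn : β.degree using Nat.strong_induction_on generalizing β with
  | _ n ih =>
  rcases eq_or_ne β 0 with rfl | hβ
  · rw [h0, forestSum_zero]
  obtain ⟨k, hk⟩ := Finsupp.ne_iff.1 hβ
  have hk : β k ≠ 0 := hk
  have hk' : (β k : ℝ) ≠ 0 := by exact_mod_cast hk
  refine mul_left_cancel₀ hk' ?_
  rw [hE, mul_forestSum hc]
  refine Finset.sum_congr rfl fun γ hγ => ?_
  -- The factor `γ k` removes the term `γ = 0`, which contains the value at `β` itself.
  rcases eq_or_ne (γ k) 0 with hγk | hγk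
  · simp [hγk]
  · have hle := Finset.mem_Iic.1 hγ
    have hdeg : (β - γ).degree < n := by
      have h1 : (β - γ).degree + γ.degree = n := by
        rw [← map_add, tsub_add_cancel_of_le hle, hn]
      have h2 : γ.degree ≠ 0 := fun h => hγk (by
        rw [(Finsupp.degree_eq_zero_iff γ).1 h]; rfl)
      omega
    rw [ih _ hdeg _ rfl]

/-- The recursive definition of `connectedPart` inverts the sum over forests. -/
theorem connectedPart_forestSum {c : (ℕ →₀ ℕ) → ℝ} (hc : ∀ γ, γ ∉ admissible → c γ = 0)
    {β : ℕ →₀ ℕ} (hβ : β ≠ 0) : connectedPart (forestSum c) β = c β := by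
  induction hn : β.degree using Nat.strong_induction_on generalizing β with
  | _ n ih =>
  rw [connectedPart_eq, forestSum_eq_add hc hβ, sub_eq_iff_eq_add]
  congr 1
  refine Finset.sum_congr rfl fun f hf => ?_
  rw [mem_splittings] at hf
  congr 2
  refine Multiset.map_congr rfl fun γ hγ => ?_
  exact (ih _ (hn ▸ degree_lt_of_mem hf hγ) (ne_zero_of_admissible (hf.2.1 γ hγ)) rfl).symm

end MultiIndex

/-! ### Isomorphism classes of multigraphs -/

namespace MultiGraph

variable {V E V' E' : Type}

theorem Iso.isConnected {G : MultiGraph V E} {G' : MultiGraph V' E'} (f : G.Iso G')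
    (h : G.IsConnected) : G'.IsConnected := by
  refine (SimpleGraph.Iso.connected_iff ⟨f.onV, fun {u v} => ?_⟩).1 h
  rw [SimpleGraph.fromEdgeSet_adj, SimpleGraph.fromEdgeSet_adj, f.onV.injective.ne_iff]
  refine and_congr_left fun _ => ?_
  have hinj := Sym2.map.injective f.onV.injective
  simp only [Set.mem_range]
  refine (f.onE.exists_congr fun e => ?_).symm
  rw [f.ends_onE, ← hinj.eq_iff, Sym2.map_mk]

/-- An isomorphism `G ≅ G'` identifies the isomorphisms from `G` to `G'` with automorphisms. -/
def Iso.equivAut {G : MultiGraph V E} {G' : MultiGraph V' E'} (f : G.Iso G') :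
    G.Iso G' ≃ G.Iso G where
  toFun g := g.trans f.symm
  invFun g := g.trans f
  left_inv _ := by apply Iso.ext <;> ext x <;> simp [Iso.symm, Iso.trans]
  right_inv _ := by apply Iso.ext <;> ext x <;> simp [Iso.symm, Iso.trans]

instance [Finite V] [Finite E] [Finite V'] [Finite E'] (G : MultiGraph V E)
    (G' : MultiGraph V' E') : Finite (G.Iso G') :=
  Finite.of_injective (fun f : G.Iso G' => (f.onV, f.onE)) fun _ _ h =>
    Iso.ext (congrArg Prod.fst h) (congrArg Prod.snd h)

end MultiGraph

namespace FeynmanDiagram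

variable {V E : Type} {Γ Γ' : FeynmanDiagram} {G : MultiGraph V E}

theorem exists_isClassOf [Fintype V] [Fintype E] (hG : G.IsConnected) :
    ∃ Γ : FeynmanDiagram, Γ.IsClassOf G := by
  let eV := Fintype.equivFin V
  let eE := Fintype.equivFin E
  let G' : MultiGraph (Fin (Fintype.card V)) (Fin (Fintype.card E)) :=
    { ends := fun e => (G.ends (eE.symm e)).map eV
      not_isDiag := fun e => by
        rw [Sym2.isDiag_map eV.injective]
        exact G.not_isDiag _ }
  let f : G.Iso G' := ⟨eV, eE, fun e => by simp [G']⟩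
  exact ⟨Quotient.mk LabelledDiagram.setoid ⟨_, _, G', f.isConnected hG⟩, ⟨f.symm⟩⟩

theorem IsClassOf.unique (h : Γ.IsClassOf G) (h' : Γ'.IsClassOf G) : Γ = Γ' := by
  induction Γ using Quotient.inductionOn with
  | h D =>
    induction Γ' using Quotient.inductionOn with
    | h D' =>
      obtain ⟨f⟩ := h
      obtain ⟨f'⟩ := h'
      exact Quotient.sound ⟨f.trans f'.symm⟩

theorem IsClassOf.isConnected (h : Γ.IsClassOf G) : G.IsConnected := by
  induction Γ using Quotient.inductionOn with
  | h D =>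
    obtain ⟨f⟩ := h
    exact f.isConnected D.isConnected

theorem IsClassOf.counting_eq [Fintype V] (h : Γ.IsClassOf G) : Γ.counting = G.arities := by
  induction Γ using Quotient.inductionOn with
  | h D =>
    obtain ⟨f⟩ := h
    exact f.arities_eq

theorem IsClassOf.valuation_eq {Λ : Type*} [AddCommGroup Λ] [MeasurableSpace Λ] [Fintype V]
    [Fintype E] (h : Γ.IsClassOf G) (μ : Measure Λ) [SigmaFinite μ] (K : Λ → ℝ)
    (hK : Function.Even K) : Γ.valuation μ K hK = G.valuation μ K hK := by
  induction Γ using Quotient.inductionOn with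
  | h D =>
    obtain ⟨f⟩ := h
    exact f.valuation_eq μ K hK

end FeynmanDiagram

/-! ### The multigraphs formed by pairings -/

namespace MultiIndex

variable {β : ℕ →₀ ℕ}

theorem Pairing.ext_pairs {p q : Pairing β} (h : p.pairs = q.pairs) : p = q := by
  cases p
  cases q
  cases h
  rfl

instance : Finite (Pairing β) :=
  Finite.of_injective Pairing.pairs fun _ _ h => Pairing.ext_pairs h

noncomputable instance (p : Pairing β) : Fintype p.pairs := Fintype.ofFinite _

/-- The pairs of a pairing as a finite set. -/
noncomputable def Pairing.finset (p : Pairing β) : Finset (Sym2 (HalfEdge β)) := p.pairs.toFinset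

theorem Pairing.mem_finset {p : Pairing β} {q : Sym2 (HalfEdge β)} :
    q ∈ p.finset ↔ q ∈ p.pairs := Set.mem_toFinset

theorem Pairing.isPairing_finset (p : Pairing β) :
    IsPairing (Sigma.fst : HalfEdge β → Vertex β) Finset.univ p.finset :=
  ⟨fun h _ => by simpa only [p.mem_finset] using p.existsUnique_mem h,
    fun q hq => ⟨fun _ _ => Finset.mem_univ _, p.not_isDiag q (p.mem_finset.1 hq)⟩⟩

theorem Pairing.exists_finset_eq {Q : Finset (Sym2 (HalfEdge β))}
    (hQ : IsPairing (Sigma.fst : HalfEdge β → Vertex β) Finset.univ Q) :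
    ∃ p : Pairing β, p.finset = Q :=
  ⟨⟨Q, fun h => hQ.1 h (Finset.mem_univ _), fun q hq => (hQ.2 q hq).2⟩, by
    ext q
    rw [Pairing.mem_finset]
    rfl⟩

theorem Pairing.finset_injective : Function.Injective (Pairing.finset (β := β)) :=
  fun _ _ h => Pairing.ext_pairs (Set.toFinset_inj.1 h)

theorem Pairing.isConnected_graph_iff (p : Pairing β) :
    p.graph.IsConnected ↔ (pairingGraph Sigma.fst p.finset).Connected := by
  have h : Set.range p.graph.ends = Sym2.map Sigma.fst '' (p.finset : Set (Sym2 (HalfEdge β))) := by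
    ext e
    simp only [Set.mem_range, Set.mem_image, Finset.mem_coe, p.mem_finset]
    exact ⟨fun ⟨q, hq⟩ => ⟨q.1, q.2, hq⟩, fun ⟨q, hq, he⟩ => ⟨⟨q, hq⟩, he⟩⟩
  rw [MultiGraph.IsConnected, h, pairingGraph]

theorem Pairing.valuation_graph {Λ : Type*} [AddCommGroup Λ] [MeasurableSpace Λ] (μ : Measure Λ)
    (K : Λ → ℝ) (hK : Function.Even K) (p : Pairing β) :
    p.graph.valuation μ K hK = pairingValuation μ K hK Sigma.fst p.finset := by
  unfold MultiGraph.valuation pairingValuation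
  congr 1
  funext x
  rw [Pairing.finset, ← Finset.prod_set_coe]
  refine Finset.prod_congr rfl fun q _ => ?_
  rw [← Sym2.map_map]
  rfl

/-- Each half-edge of a vertex belongs to a single edge of this vertex, and edges have two different
end points. -/
theorem Pairing.arity_graph (p : Pairing β) (u : Vertex β) : p.graph.arity u = u.1 := by
  choose q hq hu using p.existsUnique_mem
  have hmem (i : Fin (u.1 : ℕ)) : u ∈ p.graph.ends ⟨q ⟨u, i⟩, (hq _).1⟩ :=
    Sym2.mem_map.2 ⟨⟨u, i⟩, (hq _).2, rfl⟩
  have hb : Function.Bijective fun i : Fin (u.1 : ℕ) =>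
      (⟨⟨q ⟨u, i⟩, (hq _).1⟩, hmem i⟩ : {e : p.pairs // u ∈ p.graph.ends e}) := by
    constructor
    · intro i j hij
      have h1 : q ⟨u, i⟩ = q ⟨u, j⟩ := congrArg (fun e => e.1.1) hij
      by_contra hne
      have h2 : q ⟨u, i⟩ = s(⟨u, i⟩, ⟨u, j⟩) :=
        (Sym2.mem_and_mem_iff (by simpa using hne)).1 ⟨(hq _).2, h1 ▸ (hq _).2⟩
      have h3 := p.not_isDiag _ (hq ⟨u, i⟩).1
      rw [h2] at h3
      exact h3 rfl
    · rintro ⟨⟨e, he⟩, hue⟩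
      obtain ⟨⟨w, i⟩, hi, rfl⟩ := Sym2.mem_map.1 hue
      exact ⟨i, Subtype.ext (Subtype.ext (hu _ e ⟨he, hi⟩).symm)⟩
  rw [MultiGraph.arity, ← Nat.card_eq_of_bijective _ hb, Nat.card_fin]

theorem Pairing.arities_graph (p : Pairing β) : p.graph.arities = β := by
  unfold MultiGraph.arities
  simp_rw [p.arity_graph]
  exact ofVertices_univ β

theorem connectedPairingSum_eq_zero {Λ : Type*} [AddCommGroup Λ] [MeasurableSpace Λ]
    {μ : Measure Λ} {K : Λ → ℝ} {hK : Function.Even K} (hβ : β ∉ admissible) :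
    connectedPairingSum μ K hK β = 0 := by
  refine Finset.sum_eq_zero fun Q hQ => absurd ?_ hβ
  rw [mem_connectedPairings] at hQ
  obtain ⟨p, rfl⟩ := Pairing.exists_finset_eq hQ.1
  obtain ⟨Γ, hΓ⟩ := FeynmanDiagram.exists_isClassOf (p.isConnected_graph_iff.2 hQ.2)
  exact ⟨Γ, by rw [hΓ.counting_eq, p.arities_graph]⟩

theorem card_pairing_isClassOf {Γ : FeynmanDiagram} (h : Γ.counting = β) :
    Nat.card {p : Pairing β // Γ.IsClassOf p.graph} = Γ.pairingCount := by
  subst h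
  rfl

section

variable {Λ : Type*} [AddCommGroup Λ] [MeasurableSpace Λ] {μ : Measure Λ} [SigmaFinite μ]
  {K : Λ → ℝ} {hK : Function.Even K}

/-- The connected pairings are sorted by the isomorphism class of the graph which they form. -/
theorem connectedPairingSum_eq_sum_fibre (hβ : β ∈ admissible) :
    connectedPairingSum μ K hK β =
      ∑ Γ ∈ FeynmanDiagram.fibre β, (Γ.pairingCount : ℝ) * Γ.valuation μ K hK := by
  classical
  have : Fintype (Pairing β) := Fintype.ofFinite _
  have : Nonempty FeynmanDiagram := ⟨hβ.choose⟩
  have h1 : connectedPairingSum μ K hK β =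
      ∑ p : Pairing β with p.graph.IsConnected, p.graph.valuation μ K hK := by
    symm
    refine Finset.sum_bij (fun p _ => p.finset) ?_ ?_ ?_ ?_
    · intro p hp
      rw [mem_connectedPairings]
      exact ⟨p.isPairing_finset, p.isConnected_graph_iff.1 (Finset.mem_filter.1 hp).2⟩
    · exact fun _ _ _ _ h => Pairing.finset_injective h
    · intro Q hQ
      rw [mem_connectedPairings] at hQ
      obtain ⟨p, rfl⟩ := Pairing.exists_finset_eq hQ.1
      exact ⟨p, by simpa using p.isConnected_graph_iff.2 hQ.2, rfl⟩
    · exact fun p _ => p.valuation_graph μ K hK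
  have h2 (p : Pairing β) (hp : p.graph.IsConnected) :
      ∃ Γ : FeynmanDiagram, Γ.IsClassOf p.graph := FeynmanDiagram.exists_isClassOf hp
  choose! cls hcls using h2
  rw [h1, ← Finset.sum_fiberwise_of_maps_to (t := FeynmanDiagram.fibre β) (g := cls)]
  · refine Finset.sum_congr rfl fun Γ hΓ => ?_
    rw [Finset.sum_congr rfl (g := fun _ => Γ.valuation μ K hK), Finset.sum_const, nsmul_eq_mul,
      ← card_pairing_isClassOf (FeynmanDiagram.mem_fibre.1 hΓ), Nat.card_eq_fintype_card,
      Fintype.card_subtype, Finset.filter_filter]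
    · congr 3
      ext p
      simp only [Finset.mem_filter, Finset.mem_univ, true_and]
      constructor
      · rintro ⟨hp, rfl⟩
        exact hcls p hp
      · intro h
        exact ⟨h.isConnected, (hcls p h.isConnected).unique h⟩
    · intro p hp
      simp only [Finset.mem_filter, Finset.mem_univ, true_and] at hp
      obtain ⟨hp, rfl⟩ := hp
      exact ((hcls p hp).valuation_eq μ K hK).symm
  · intro p hp
    rw [FeynmanDiagram.mem_fibre, (hcls p (Finset.mem_filter.1 hp).2).counting_eq,
      p.arities_graph]

end

/-! ### The number of pairings which form a given graph -/

section Count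

variable {V E : Type} (G : MultiGraph V E)

/-- A labelling of the half-edges of `G` by those of `z^β`: a bijection of the vertices which
respects the arities, and for each vertex a numbering of the edges attached to it. -/
abbrev HalfEdgeLabelling (β : ℕ →₀ ℕ) : Type :=
  Σ e : {e : V ≃ Vertex β // ∀ v, ((e v).1 : ℕ) = G.arity v},
    ∀ v, {a : E // v ∈ G.ends a} ≃ Fin ((e.1 v).1 : ℕ)

theorem card_perm_vertex (β : ℕ →₀ ℕ) :
    Nat.card {σ : Equiv.Perm (Vertex β) // ∀ u, (σ u).1 = u.1} = β.prod fun _ b => b ! := by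
  classical
  have h := DomMulAct.stabilizer_card (fun u : Vertex β => u.1)
  have h1 : Nat.card {σ : Equiv.Perm (Vertex β) // ∀ u, (σ u).1 = u.1} =
      Fintype.card {g : Equiv.Perm (Vertex β) //
        (fun u : Vertex β => u.1) ∘ g = fun u : Vertex β => u.1} := by
    rw [← Nat.card_eq_fintype_card]
    exact Nat.card_congr (Equiv.subtypeEquivRight fun σ => by simp [funext_iff])
  rw [h1, h, Finsupp.prod, ← Finset.prod_coe_sort β.support fun k => (β k)!]
  refine Finset.prod_congr rfl fun k _ => ?_
  rw [Fintype.card_congr (Equiv.sigmaSubtype (β := fun k : β.support => Fin (β k)) k),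
    Fintype.card_fin]

theorem card_halfEdgeLabelling [Fintype V] [Fintype E] (hG : G.arities = β) :
    Nat.card (HalfEdgeLabelling G β) = symmetryFactor β := by
  classical
  obtain ⟨e₀, he₀⟩ := exists_equiv_vertex G.arity (γ := β) hG
  have : Finite {e : V ≃ Vertex β // ∀ v, ((e v).1 : ℕ) = G.arity v} := inferInstance
  have : Fintype {e : V ≃ Vertex β // ∀ v, ((e v).1 : ℕ) = G.arity v} := Fintype.ofFinite _
  have h1 (e : {e : V ≃ Vertex β // ∀ v, ((e v).1 : ℕ) = G.arity v}) :
      Nat.card (∀ v, {a : E // v ∈ G.ends a} ≃ Fin ((e.1 v).1 : ℕ)) =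
        β.prod fun k b => (k !) ^ b := by
    rw [Nat.card_pi]
    have h2 (v : V) : Nat.card ({a : E // v ∈ G.ends a} ≃ Fin ((e.1 v).1 : ℕ)) =
        ((e.1 v).1 : ℕ)! := by
      have hc : Fintype.card {a : E // v ∈ G.ends a} = ((e.1 v).1 : ℕ) := by
        rw [e.2 v, MultiGraph.arity, Nat.card_eq_fintype_card]
      rw [Nat.card_eq_fintype_card, Fintype.card_equiv (Fintype.equivFinOfCardEq hc), hc]
    simp_rw [h2]
    rw [Fintype.prod_equiv e.1 _ (fun u : Vertex β => (u.1 : ℕ)!) fun _ => rfl,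
      Fintype.prod_sigma, Finsupp.prod, ← Finset.prod_coe_sort β.support fun k => (k !) ^ β k]
    simp only [Finset.prod_const, Finset.card_univ, Fintype.card_fin]
  have h3 : Nat.card {e : V ≃ Vertex β // ∀ v, ((e v).1 : ℕ) = G.arity v} =
      β.prod fun _ b => b ! := by
    rw [← card_perm_vertex]
    refine Nat.card_congr ((Equiv.equivCongr e₀ (Equiv.refl _)).subtypeEquiv fun e => ?_)
    refine e₀.forall_congr fun v => ?_
    change _ ↔ (e (e₀.symm (e₀ v))).1 = (e₀ v).1
    rw [Equiv.symm_apply_apply, Subtype.ext_iff, he₀]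
  rw [Nat.card_sigma]
  simp_rw [h1]
  rw [Finset.sum_const, Finset.card_univ, ← Nat.card_eq_fintype_card, h3, smul_eq_mul,
    symmetryFactor, ← Finsupp.prod_mul]

/-- A way to form the graph `G` from the half-edges of `z^β`: a bijection of the vertices and for
each edge of `G` a pair of half-edges of its end points, such that each half-edge is used once. -/
abbrev GraphRealization (β : ℕ →₀ ℕ) : Type :=
  {x : (V ≃ Vertex β) × (E → Sym2 (HalfEdge β)) //
    (∀ a, (x.2 a).map Sigma.fst = (G.ends a).map x.1) ∧ ∀ h, ∃! a, h ∈ x.2 a}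

/-- A pairing together with an isomorphism from `G` to its graph is the same as a realization: the
pairing consists of the pairs which are used by the edges of `G`. -/
theorem bijective_iso_to_realization : Function.Bijective
    fun x : Σ p : Pairing β, G.Iso p.graph =>
      (⟨(x.2.onV, fun a => (x.2.onE a).1), fun a => x.2.ends_onE a, fun h => by
        obtain ⟨q, ⟨hq, hhq⟩, hu⟩ := x.1.existsUnique_mem h
        refine ⟨x.2.onE.symm ⟨q, hq⟩, by simpa using hhq, fun a ha => ?_⟩
        rw [Equiv.eq_symm_apply]
        exact Subtype.ext (hu _ ⟨(x.2.onE a).2, ha⟩)⟩ : GraphRealization G β) := by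
  constructor
  · rintro ⟨p, f⟩ ⟨p', f'⟩ h
    have hV : f.onV = f'.onV := congrArg (fun x => x.1.1) h
    have hE (a : E) : (f.onE a).1 = (f'.onE a).1 := congrArg (fun x => x.1.2 a) h
    have hp : p = p' := by
      refine Pairing.ext_pairs (Set.Subset.antisymm ?_ ?_)
      · intro q hq
        obtain ⟨a, ha⟩ := f.onE.surjective ⟨q, hq⟩
        have := hE a
        rw [ha] at this
        rw [show q = _ from this]
        exact (f'.onE a).2
      · intro q hq
        obtain ⟨a, ha⟩ := f'.onE.surjective ⟨q, hq⟩
        have := hE a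
        rw [ha] at this
        rw [show q = _ from this.symm]
        exact (f.onE a).2
    subst hp
    congr 1
    exact MultiGraph.Iso.ext hV (Equiv.ext fun a => Subtype.ext (hE a))
  · rintro ⟨⟨e, ψ⟩, hψ, hu⟩
    have hinj : Function.Injective ψ := fun a b hab => by
      have ha := Sym2.out_fst_mem (ψ a)
      exact (hu _).unique ha (hab ▸ ha)
    let p : Pairing β :=
      { pairs := Set.range ψ
        existsUnique_mem := fun h => by
          obtain ⟨a, ha, hua⟩ := hu h
          refine ⟨ψ a, ⟨⟨a, rfl⟩, ha⟩, ?_⟩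
          rintro _ ⟨⟨b, rfl⟩, hb⟩
          rw [hua b hb]
        not_isDiag := by
          rintro _ ⟨a, rfl⟩
          rw [hψ, Sym2.isDiag_map e.injective]
          exact G.not_isDiag a }
    exact ⟨⟨p, ⟨e, Equiv.ofInjective ψ hinj, hψ⟩⟩, rfl⟩

/-- A labelling of the half-edges of `G` turns each edge of `G` into a pair of half-edges of
`z^β`; conversely, each half-edge at the image of a vertex `v` is used by one edge attached to
`v`. -/
theorem card_realization_eq_card_labelling [Fintype V] [Fintype E] :
    Nat.card (HalfEdgeLabelling G β) = Nat.card (GraphRealization G β) := by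
  classical
  let η (x : HalfEdgeLabelling G β) (a : E) (v : V) (hv : v ∈ G.ends a) : HalfEdge β :=
    ⟨x.1.1 v, x.2 v ⟨a, hv⟩⟩
  let pr (x : HalfEdgeLabelling G β) (a : E) : Sym2 (HalfEdge β) :=
    (G.ends a).pmap (η x a) fun _ hv => hv
  have mem_pr (x : HalfEdgeLabelling G β) (a : E) (v : V) (i : Fin ((x.1.1 v).1 : ℕ)) :
      (⟨x.1.1 v, i⟩ : HalfEdge β) ∈ pr x a ↔ ∃ hv : v ∈ G.ends a, x.2 v ⟨a, hv⟩ = i := by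
    simp only [pr, Sym2.mem_pmap_iff]
    constructor
    · rintro ⟨w, hw, he⟩
      have h1 : v = w := x.1.1.injective (congrArg Sigma.fst he)
      subst h1
      exact ⟨hw, (eq_of_heq (Sigma.mk.inj he).2).symm⟩
    · rintro ⟨hv, rfl⟩
      exact ⟨v, hv, rfl⟩
  have hmap (x : HalfEdgeLabelling G β) (a : E) :
      (pr x a).map Sigma.fst = (G.ends a).map x.1.1 := by
    simp only [pr]
    rw [Sym2.pmap_map (Q := fun _ => True) (h' := fun _ _ => trivial)]
    exact Sym2.pmap_eq_map x.1.1 _ fun _ hv => hv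
  have huniq (x : HalfEdgeLabelling G β) (h : HalfEdge β) : ∃! a, h ∈ pr x a := by
    obtain ⟨u, i⟩ := h
    obtain ⟨v, rfl⟩ := x.1.1.surjective u
    refine ⟨((x.2 v).symm i).1, (mem_pr x _ v i).2 ⟨((x.2 v).symm i).2, by simp⟩, fun a ha => ?_⟩
    obtain ⟨hv, rfl⟩ := (mem_pr x a v i).1 ha
    simp
  refine Nat.card_eq_of_bijective
    (fun x => (⟨(x.1.1, pr x), hmap x, huniq x⟩ : GraphRealization G β)) ⟨?_, ?_⟩
  · intro x y hxy
    have hpr (a : E) : pr x a = pr y a := congrArg (fun z => z.1.2 a) hxy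
    have he : x.1 = y.1 := Subtype.ext (congrArg (fun z => z.1.1) hxy)
    obtain ⟨e, F⟩ := x
    obtain ⟨e', F'⟩ := y
    obtain rfl : e = e' := he
    congr 1
    funext v
    ext1 ⟨a, hv⟩
    have h1 := (mem_pr ⟨e, F⟩ a v (F v ⟨a, hv⟩)).2 ⟨hv, rfl⟩
    rw [hpr a, mem_pr ⟨e, F'⟩ a v] at h1
    exact h1.choose_spec.symm
  · rintro ⟨⟨e, ψ⟩, hψ, hu⟩
    replace hψ : ∀ a, (ψ a).map Sigma.fst = (G.ends a).map e := hψ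
    have hu' : ∀ h, ∃! a, h ∈ ψ a := hu
    choose c hc huc using hu'
    have hmem (v : V) (i : Fin ((e v).1 : ℕ)) : v ∈ G.ends (c ⟨e v, i⟩) := by
      have h1 : e v ∈ (G.ends (c ⟨e v, i⟩)).map e := by
        rw [← hψ]
        exact Sym2.mem_map.2 ⟨_, hc _, rfl⟩
      obtain ⟨w, hw, hwv⟩ := Sym2.mem_map.1 h1
      obtain rfl : w = v := e.injective hwv
      exact hw
    have hb (v : V) : Function.Bijective fun i : Fin ((e v).1 : ℕ) =>
        (⟨c ⟨e v, i⟩, hmem v i⟩ : {a : E // v ∈ G.ends a}) := by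
      constructor
      · intro i j hij
        have h1 : c ⟨e v, i⟩ = c ⟨e v, j⟩ := congrArg Subtype.val hij
        by_contra hne
        have h2 : ψ (c ⟨e v, i⟩) = s(⟨e v, i⟩, ⟨e v, j⟩) :=
          (Sym2.mem_and_mem_iff (by simpa using hne)).1 ⟨hc _, h1 ▸ hc _⟩
        have h3 := hψ (c ⟨e v, i⟩)
        rw [h2] at h3
        have h4 := G.not_isDiag (c ⟨e v, i⟩)
        rw [← Sym2.isDiag_map e.injective, ← h3] at h4
        exact h4 rfl
      · rintro ⟨a, hv⟩
        have h1 : e v ∈ (ψ a).map Sigma.fst := by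
          rw [hψ]
          exact Sym2.mem_map.2 ⟨v, hv, rfl⟩
        obtain ⟨⟨w, i⟩, hi, hw⟩ := Sym2.mem_map.1 h1
        obtain rfl : w = e v := hw
        exact ⟨i, Subtype.ext (huc _ a hi).symm⟩
    let F (v : V) : {a : E // v ∈ G.ends a} ≃ Fin ((e v).1 : ℕ) :=
      (Equiv.ofBijective _ (hb v)).symm
    let x : HalfEdgeLabelling G β := ⟨⟨e, fun v => by
      rw [MultiGraph.arity, Nat.card_congr (F v), Nat.card_fin]⟩, F⟩
    refine ⟨x, Subtype.ext (Prod.ext rfl (funext fun a => ?_))⟩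
    refine Sym2.ext fun h => ?_
    obtain ⟨u, i⟩ := h
    obtain ⟨v, rfl⟩ := e.surjective u
    refine (mem_pr x a v i).trans ⟨?_, fun h => ?_⟩
    · rintro ⟨hv, rfl⟩
      have h1 := congrArg Subtype.val ((Equiv.ofBijective _ (hb v)).apply_symm_apply ⟨a, hv⟩)
      have h2 := hc ⟨e v, F v ⟨a, hv⟩⟩
      have h3 : c ⟨e v, F v ⟨a, hv⟩⟩ = a := h1
      rwa [h3] at h2
    · have h1 : a = c ⟨e v, i⟩ := huc _ a h
      subst h1
      exact ⟨hmem v i, (Equiv.ofBijective _ (hb v)).symm_apply_apply i⟩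

end Count

end MultiIndex

theorem FeynmanDiagram.symmetryFactor_ne_zero (Γ : FeynmanDiagram) : Γ.symmetryFactor ≠ 0 := by
  induction Γ using Quotient.inductionOn with
  | h D =>
    have : Nonempty (D.graph.Iso D.graph) := ⟨MultiGraph.Iso.refl _⟩
    exact Nat.card_pos.ne'

/-- The pairs of a pairing `p` and an isomorphism from `Γ` to the graph of `p` are counted in two
ways: each of the `N(Γ)` pairings has `|Aut Γ|` isomorphisms, and the pairs correspond to the
labellings of the half-edges of `Γ`. -/
theorem FeynmanDiagram.pairingCount_mul_symmetryFactor (Γ : FeynmanDiagram) :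
    Γ.pairingCount * Γ.symmetryFactor = MultiIndex.symmetryFactor Γ.counting := by
  classical
  induction Γ using Quotient.inductionOn with
  | h D =>
    set β := FeynmanDiagram.counting ⟦D⟧ with hβ
    have hG : D.graph.arities = β := rfl
    have : Fintype (MultiIndex.Pairing β) := Fintype.ofFinite _
    have hcard (p : MultiIndex.Pairing β) : Nat.card (D.graph.Iso p.graph) =
        if FeynmanDiagram.IsClassOf ⟦D⟧ p.graph then Nat.card (D.graph.Iso D.graph) else 0 := by
      split_ifs with h
      · exact Nat.card_congr h.some.equivAut
      · exact @Nat.card_of_isEmpty _ (not_nonempty_iff.1 h)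
    rw [← MultiIndex.card_halfEdgeLabelling D.graph hG,
      MultiIndex.card_realization_eq_card_labelling,
      ← Nat.card_eq_of_bijective _ (MultiIndex.bijective_iso_to_realization D.graph),
      Nat.card_sigma]
    simp_rw [hcard]
    rw [← Finset.sum_filter, Finset.sum_const, smul_eq_mul, ← Fintype.card_subtype,
      ← Nat.card_eq_fintype_card]
    rfl

namespace MultiIndex

theorem pairingSum_zero {Λ : Type*} [AddCommGroup Λ] [MeasurableSpace Λ] (μ : Measure Λ)
    [SigmaFinite μ] (K : Λ → ℝ) (hK : Function.Even K) : pairingSum μ K hK 0 = 1 := by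
  have h1 : IsEmpty (Vertex 0) := ⟨fun u => u.2.elim0⟩
  have h2 : IsEmpty (HalfEdge 0) := ⟨fun h => h1.elim h.1⟩
  rw [pairingSum, Finset.univ_eq_empty, pairings_empty, Finset.sum_singleton, pairingValuation]
  simp [measureReal_def]

end MultiIndex

theorem corollary3 {Λ Ω : Type*} [AddCommGroup Λ] [MeasurableSpace Λ] [MeasurableSpace Ω]
    (μ : Measure Λ) [IsFiniteMeasure μ] (P : Measure Ω) [IsProbabilityMeasure P]
    (K : Λ → ℝ) (hK : Function.Even K)
    (X : Λ → Ω → ℝ) (hX_meas : Measurable (Function.uncurry X))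
    (hX_gauss : IsGaussianProcess X P)
    (hX_centred : ∀ x, ∫ ω, X x ω ∂P = 0)
    (hX_cov : ∀ x y, ∫ ω, X x ω * X y ω ∂P = K (x - y))
    (β : ℕ →₀ ℕ) (hβ : β ∈ MultiIndex.admissible) :
    MultiIndex.valuation μ P X β = valuationF μ K hK (MultiIndex.mapP β) ∧
    MultiIndex.valuation μ P X β =
      ∑ Γ ∈ FeynmanDiagram.fibre β, (Γ.pairingCount : ℝ) * Γ.valuation μ K hK := by
  have hc (γ : ℕ →₀ ℕ) (hγ : γ ∉ MultiIndex.admissible) :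
      MultiIndex.connectedPairingSum μ K hK γ = 0 := MultiIndex.connectedPairingSum_eq_zero hγ
  have hE : MultiIndex.moment μ P X =
      MultiIndex.forestSum (MultiIndex.connectedPairingSum μ K hK) := by
    funext γ
    rw [moment_eq_sum_pairings (hK := hK) hX_meas hX_gauss hX_centred hX_cov γ]
    exact MultiIndex.eq_forestSum hc (MultiIndex.pairingSum_zero μ K hK)
      MultiIndex.mul_pairingSum γ
  have hN : MultiIndex.valuation μ P X β =
      ∑ Γ ∈ FeynmanDiagram.fibre β, (Γ.pairingCount : ℝ) * Γ.valuation μ K hK := by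
    rw [MultiIndex.valuation, hE,
      MultiIndex.connectedPart_forestSum hc (MultiIndex.ne_zero_of_admissible hβ),
      MultiIndex.connectedPairingSum_eq_sum_fibre hβ]
  refine ⟨?_, hN⟩
  rw [hN, valuationF, MultiIndex.mapP, map_sum]
  refine Finset.sum_congr rfl fun Γ hΓ => ?_
  rw [Finsupp.linearCombination_single, smul_eq_mul, ← FeynmanDiagram.mem_fibre.1 hΓ,
    ← Γ.pairingCount_mul_symmetryFactor, Nat.cast_mul,
    mul_div_cancel_right₀ _ (Nat.cast_ne_zero.2 Γ.symmetryFactor_ne_zero)]
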